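/- A monotone circuit is a Boolean circuit built from $\wedge$ and $\vee$ gates of fan-in two (with unbounded fan-out, and with input variables and the constants $0,1$ available for free); its size is the number of its gates, and the monotone complexity of a Boolean function is the least size of a monotone circuit computing it. For integers $n,k$ let $\mathrm{Clique}_k:\{0,1\}^{\binom n2}\to\{0,1\}$ be the function whose input encodes a graph $G$ on $n$ vertices (one bit for each pair of distinct vertices) and whose value is $1$ if and only if $G$ contains a clique on $k$ vertices. Let the monotone complexity of $\mathrm{Clique}$ on $n$-vertex graphs be the maximum over $0\le k\le n$ of the monotone complexity of $\mathrm{Clique}_k$. Below, $\log$ is the natural logarithm. (i) There are an absolute constant $c>0$ and an $N$ such that for all integers $n\ge N$, all real $\delta>0$ and all integers $k\ge 2$ with $k\le n^{1/2-\delta}/\log^2 n$, the monotone complexity of $\mathrm{Clique}_k$ on $n$-vertex graphs is at least $n^{c\,\delta^2 k}$. (ii) In particular, the monotone complexity of $\mathrm{Clique}$ is $2^{\tilde\Omega(\sqrt n)}$: there are a constant $c>0$, an integer $a\ge 0$ and an $N$ such that for all $n\ge N$ the monotone complexity of $\mathrm{Clique}$ on $n$-vertex graphs is at least $2^{c\sqrt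 n/(\log n)^a}$. -/

import Mathlib

/-- A wire available after `m` gates: an input variable, a constant, or the value of one of
the `m` gates. -/
inductive MonotoneWire (ι : Type) (m : ℕ) : Type
  | input (i : ι) : MonotoneWire ι m
  | const (b : Bool) : MonotoneWire ι m
  | gate (j : Fin m) : MonotoneWire ι m

/-- The gates of a monotone circuit with `m` gates on inputs indexed by `ι`, in topological order.
Each gate is an `∧` or `∨` of fan-in two of wires that are already available; fan-out is
unbounded. -/
inductive MonotoneGates (ι : Type) : ℕ → Type
  | nil : MonotoneGates ι 0
  | and {m : ℕ} (C : MonotoneGates ι m) (a b : MonotoneWire ι m) : MonotoneGates ι (m + 1)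
  | or {m : ℕ} (C : MonotoneGates ι m) (a b : MonotoneWire ι m) : MonotoneGates ι (m + 1)

/-- The value of a wire, given the input `x` and the values `g` of the gates. -/
def MonotoneWire.eval {ι : Type} {m : ℕ} (x : ι → Bool) (g : Fin m → Bool) :
    MonotoneWire ι m → Bool
  | .input i => x i
  | .const b => b
  | .gate j => g j

/-- The values of all gates on the input `x`. -/
def MonotoneGates.eval {ι : Type} (x : ι → Bool) :
    {m : ℕ} → MonotoneGates ι m → (Fin m → Bool)
  | _, .nil => Fin.elim0
  | _, .and C a b => Fin.snoc (C.eval x) (a.eval x (C.eval x) && b.eval x (C.eval x))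
  | _, .or C a b => Fin.snoc (C.eval x) (a.eval x (C.eval x) || b.eval x (C.eval x))

/-- A monotone Boolean circuit. Its size is the number of its `∧` and `∨` gates; input variables
and constants are free. -/
structure MonotoneCircuit (ι : Type) where
  size : ℕ
  gates : MonotoneGates ι size
  output : MonotoneWire ι size

/-- The Boolean value that the circuit outputs on the input `x`. -/
def MonotoneCircuit.eval {ι : Type} (C : MonotoneCircuit ι) (x : ι → Bool) : Bool :=
  C.output.eval x (C.gates.eval x)

/-- The circuit `C` computes the Boolean function `f`. -/
def MonotoneCircuit.Computes {ι : Type} (C : MonotoneCircuit ι) (f : (ι → Bool) → Bool) : Prop :=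
  ∀ x, C.eval x = f x

/-- The monotone circuit complexity of `f`: the least size of a monotone circuit computing `f`
(every monotone `f` on finitely many inputs is computed by one, see
`exists_monotoneCircuit_computes`). -/
noncomputable def monotoneComplexity {ι : Type} (f : (ι → Bool) → Bool) : ℕ :=
  sInf {s : ℕ | ∃ C : MonotoneCircuit ι, C.Computes f ∧ C.size = s}

/-- The potential edges of a graph on `n` vertices: there are `n.choose 2` of them. -/
abbrev PotentialEdge (n : ℕ) : Type := {e : Sym2 (Fin n) // ¬ e.IsDiag}

/-- The graph on `n` vertices encoded by a bit for each potential edge. -/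
def graphOfBits {n : ℕ} (x : PotentialEdge n → Bool) : SimpleGraph (Fin n) :=
  SimpleGraph.fromEdgeSet {e | ∃ h : ¬ e.IsDiag, x ⟨e, h⟩ = true}

open Classical in
/-- The Boolean function `Clique_k` on graphs with `n` vertices: it is true exactly when the graph
contains a clique on `k` vertices. -/
noncomputable def cliqueFunction (n k : ℕ) (x : PotentialEdge n → Bool) : Bool :=
  decide (∃ s : Finset (Fin n), (graphOfBits x).IsNClique k s)

/-- The monotone complexity of the unrestricted clique problem on `n`-vertex graphs: the
monotone complexity of `Clique_k` for the hardest clique size `k ≤ n`. -/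
noncomputable def cliqueProblemComplexity (n : ℕ) : ℕ :=
  (Finset.range (n + 1)).sup fun k => monotoneComplexity (cliqueFunction n k)

/-! Well-definedness: every monotone Boolean function on finitely many inputs has a monotone
circuit, and `Clique_k` is monotone, so the infimum above is over a nonempty set. -/

/-- Any gate sequence can be extended, keeping all its values, so that `f` appears on a wire. -/
def MonotoneAppendable {ι : Type} (f : (ι → Bool) → Bool) : Prop :=
  ∀ (m : ℕ) (C : MonotoneGates ι m), ∃ (m' : ℕ) (D : MonotoneGates ι m')
    (φ : MonotoneWire ι m → MonotoneWire ι m') (w : MonotoneWire ι m'),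
    (∀ x a, (φ a).eval x (D.eval x) = a.eval x (C.eval x)) ∧ ∀ x, w.eval x (D.eval x) = f x

theorem MonotoneAppendable.const {ι : Type} (b : Bool) :
    MonotoneAppendable (fun _ : ι → Bool => b) :=
  fun m C => ⟨m, C, id, .const b, fun _ _ => rfl, fun _ => rfl⟩

theorem MonotoneAppendable.input {ι : Type} (i : ι) :
    MonotoneAppendable (fun x : ι → Bool => x i) :=
  fun m C => ⟨m, C, id, .input i, fun _ _ => rfl, fun _ => rfl⟩

/-- Reinterpret a wire after one more gate has been added. -/
def MonotoneWire.succ {ι : Type} {m : ℕ} : MonotoneWire ι m → MonotoneWire ι (m + 1)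
  | .input i => .input i
  | .const b => .const b
  | .gate j => .gate j.castSucc

theorem MonotoneWire.eval_succ {ι : Type} {m : ℕ} (x : ι → Bool) (g : Fin m → Bool) (b : Bool)
    (a : MonotoneWire ι m) :
    a.succ.eval x (Fin.snoc (α := fun _ => Bool) g b) = a.eval x g := by
  cases a <;> simp [MonotoneWire.succ, MonotoneWire.eval]

theorem MonotoneAppendable.and {ι : Type} {f g : (ι → Bool) → Bool}
    (hf : MonotoneAppendable f) (hg : MonotoneAppendable g) :
    MonotoneAppendable (fun x => f x && g x) := by
  intro m C
  obtain ⟨m₁, D₁, φ₁, w₁, h₁, e₁⟩ := hf m C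
  obtain ⟨m₂, D₂, φ₂, w₂, h₂, e₂⟩ := hg m₁ D₁
  refine ⟨m₂ + 1, .and D₂ (φ₂ w₁) w₂, fun a => (φ₂ (φ₁ a)).succ, .gate (Fin.last _), ?_, ?_⟩
  · intro x a
    simp [MonotoneGates.eval, MonotoneWire.eval_succ, h₁, h₂]
  · intro x
    simp [MonotoneGates.eval, MonotoneWire.eval.eq_3, e₁, h₂, e₂]

theorem MonotoneAppendable.or {ι : Type} {f g : (ι → Bool) → Bool}
    (hf : MonotoneAppendable f) (hg : MonotoneAppendable g) :
    MonotoneAppendable (fun x => f x || g x) := by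
  intro m C
  obtain ⟨m₁, D₁, φ₁, w₁, h₁, e₁⟩ := hf m C
  obtain ⟨m₂, D₂, φ₂, w₂, h₂, e₂⟩ := hg m₁ D₁
  refine ⟨m₂ + 1, .or D₂ (φ₂ w₁) w₂, fun a => (φ₂ (φ₁ a)).succ, .gate (Fin.last _), ?_, ?_⟩
  · intro x a
    simp [MonotoneGates.eval, MonotoneWire.eval_succ, h₁, h₂]
  · intro x
    simp [MonotoneGates.eval, MonotoneWire.eval.eq_3, e₁, h₂, e₂]

theorem MonotoneAppendable.all {ι κ : Type} (f : κ → (ι → Bool) → Bool)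
    (hf : ∀ i, MonotoneAppendable (f i)) (l : List κ) :
    MonotoneAppendable (fun x => l.all fun i => f i x) := by
  induction l with
  | nil => simpa using MonotoneAppendable.const true
  | cons i l ih => simpa using (hf i).and ih

theorem MonotoneAppendable.any {ι κ : Type} (f : κ → (ι → Bool) → Bool)
    (hf : ∀ i, MonotoneAppendable (f i)) (l : List κ) :
    MonotoneAppendable (fun x => l.any fun i => f i x) := by
  induction l with
  | nil => simpa using MonotoneAppendable.const false
  | cons i l ih => simpa using (hf i).or ih

theorem exists_monotoneCircuit_computes {ι : Type} [Finite ι] (f : (ι → Bool) → Bool)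
    (hf : Monotone f) : ∃ C : MonotoneCircuit ι, C.Computes f := by
  classical
  have := Fintype.ofFinite ι
  let F : (ι → Bool) → Bool := fun x =>
    ((Finset.univ.filter fun y : ι → Bool => f y = true).toList).any fun y =>
      ((Finset.univ.filter fun i : ι => y i = true).toList).all fun i => x i
  have hF : MonotoneAppendable F :=
    MonotoneAppendable.any _ (fun y => MonotoneAppendable.all _ MonotoneAppendable.input _) _
  have hFf : F = f := by
    funext x
    rw [Bool.eq_iff_iff]
    simp only [F, List.any_eq_true, List.all_eq_true, Finset.mem_toList, Finset.mem_filter,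
      Finset.mem_univ, true_and]
    constructor
    · rintro ⟨y, hy, hyx⟩
      have hle : y ≤ x := fun i => by
        cases h : y i with
        | false => exact Bool.false_le _
        | true => rw [hyx i h]
      have := hf hle
      rw [hy] at this
      exact Bool.eq_true_of_true_le this
    · exact fun hx => ⟨x, hx, fun _ h => h⟩
  obtain ⟨m, D, -, w, -, hw⟩ := hF 0 .nil
  exact ⟨⟨m, D, w⟩, fun x => by rw [← hFf]; exact hw x⟩

theorem cliqueFunction_monotone (n k : ℕ) : Monotone (cliqueFunction n k) := by
  intro x y hxy
  have hG : graphOfBits x ≤ graphOfBits y := by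
    apply SimpleGraph.fromEdgeSet_mono
    rintro e ⟨h, hx⟩
    exact ⟨h, Bool.eq_true_of_true_le (hx ▸ hxy ⟨e, h⟩)⟩
  intro h
  simp only [cliqueFunction, decide_eq_true_eq] at h ⊢
  obtain ⟨s, hs⟩ := h
  exact ⟨s, hs.mono hG⟩

theorem exists_monotoneCircuit_computes_clique (n k : ℕ) :
    ∃ C : MonotoneCircuit (PotentialEdge n), C.Computes (cliqueFunction n k) :=
  exists_monotoneCircuit_computes _ (cliqueFunction_monotone n k)

/-!
The proof is Razborov's method of approximations, with uniformly random colourings of the vertices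
by `k - 1` colours as negative tests: the complete multipartite graph of a colouring has no
`k`-clique. The positive tests are the single cliques on `k`-sets. An approximator is a family `F`
of sets of at most `l = k / 4` vertices; it accepts a `k`-set that contains a member of `F`, and a
colouring that is injective on a member of `F`. After each gate the family is closed: every small
set is added that makes it accept at most a fraction `exp (-M / 2)` of new colourings, where `M` is
about `14 l log n`. So closing costs little on the colourings. A `∧` gate is approximated by the
unions of at most `l` elements, and loses only `k`-sets that contain a minimal member with more
than `l / 2` elements (`AcceptsSet.meetFamily`). There are few of these, because a closed family
has at most `r ^ j` minimal members of size `j`, with `r = 16 s² M` and `s` about `log l`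
(`card_minimalMembers_le`). As `r k / n` is at most `n ^ (-2 δ) / 16`, a circuit that loses all
cliques has at least `n ^ (δ l)` gates. A circuit that keeps some of them ends with
a nonempty family, which accepts a noticeable fraction of the colourings, and again the circuit must
be large (`circuit_size_dichotomy`).

The bound on the minimal members is a sunflower lemma (`exists_sunflower_core`): more than `r ^ j`
sets of size `j` have a core `Y`, smaller than `j`, such that a random colouring that is injective
on `Y` is, up to probability `exp (-M / 2)`, injective on one of the sets. With `Y` maximal such
that many of the sets contain `Y`, the sets `B \ Y` are spread, and so are the graphs of the
injections from `B \ Y` to the colours not used on `Y`. Each of these graphs is a partial colouring,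
and it remains to see that a random colouring extends one of them.

For this the vertices are divided at random into `M` blocks. Within one block the vertices are
uncovered in `s` rounds, and `two_mul_card_not_subset_revealed_le` shows that the block alone
contains a member of the spread family with probability at least one half. In each round the part
of a typical member that is still missing is halved, up to exchanging the member for another one. If
this fails for a member, its minimal missing fragment `χ` is large; overwriting the colouring by `χ`
gives a colouring from which `χ` can be recovered up to `2 ^ R b` choices, where `R b` bounds the
part missing before the round, and by spreadness few members contain `χ`
(`exists_fragment_of_stuck`, `card_stuck_le`). For a fixed partition the blocks are independent,
which turns the probability one half into `1 - exp (-M / 2)` (`card_not_subset_graph_le`).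

For `k < 8` the count of relevant variables is enough (`choose_two_le_of_computes`). The bound for
the unrestricted problem is the case `n ^ δ = log n`.
-/

namespace CliqueLowerBound

/-! ### Spread families and partial colourings -/

section Spread

open Finset

variable {V C T ι : Type*} [Fintype V] [Fintype C] [DecidableEq C]

/-- The pairs `(v, c)` such that `f` gives `v` the colour `c` and a tag of rank below `b`: the
part of the random colouring that is known after `b` rounds. -/
def revealed (rk : T → ℕ) (b : ℕ) (f : V → C × T) : Finset (V × C) :=
  {p | (f p.1).1 = p.2 ∧ rk (f p.1).2 < b}

@[simp] lemma mem_revealed {rk : T → ℕ} {b : ℕ} {f : V → C × T} {p : V × C} :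
    p ∈ revealed rk b f ↔ (f p.1).1 = p.2 ∧ rk (f p.1).2 < b := by
  simp [revealed]

lemma revealed_mono (rk : T → ℕ) (f : V → C × T) {a b : ℕ} (h : a ≤ b) :
    revealed rk a f ⊆ revealed rk b f := by
  intro p hp
  rw [mem_revealed] at hp ⊢
  exact ⟨hp.1, hp.2.trans_le h⟩

variable [DecidableEq V]

/-- The index `i` is admissible after `b` rounds if, for every `a ≤ b`, at most `R a` of the
pairs of `H i` are still missing after `a` rounds. -/
def Admissible (H : ι → Finset (V × C)) (rk : T → ℕ) (R : ℕ → ℕ) (b : ℕ) (f : V → C × T)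
    (i : ι) : Prop :=
  ∀ a ≤ b, #(H i \ revealed rk a f) ≤ R a

/-- The index `i` is good after `b` rounds if the pairs of `H i` suffice to complete the revealed
pairs to some admissible member of the family. -/
def Good (H : ι → Finset (V × C)) (rk : T → ℕ) (R : ℕ → ℕ) (b : ℕ) (f : V → C × T)
    (i : ι) : Prop :=
  ∃ i', Admissible H rk R b f i' ∧ H i' ⊆ revealed rk b f ∪ H i

/-- No vertex of `H i` has been coloured in the first `b` rounds. -/
def Avoids (H : ι → Finset (V × C)) (rk : T → ℕ) (b : ℕ) (f : V → C × T) (i : ι) : Prop :=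
  ∀ p ∈ H i, b ≤ rk (f p.1).2

/-- The index `i` is stuck in round `b`: it was good before, and no vertex of `H i` is coloured up
to the end of the round, but the completions by `H i` miss too much to be admissible after it. -/
def Stuck (H : ι → Finset (V × C)) (rk : T → ℕ) (R : ℕ → ℕ) (b : ℕ) (f : V → C × T)
    (i : ι) : Prop :=
  Avoids H rk (b + 1) f i ∧ Good H rk R b f i ∧ ¬ Good H rk R (b + 1) f i

open Classical in
/-- A member of the family that is admissible after `b` rounds and fully revealed after `b + 1`
rounds, without its part revealed in the first `b` rounds; empty if there is no such member. -/
noncomputable def reference (H : ι → Finset (V × C)) (rk : T → ℕ) (R : ℕ → ℕ) (b : ℕ)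
    (f : V → C × T) : Finset (V × C) :=
  if h : ∃ i, Admissible H rk R b f i ∧ H i ⊆ revealed rk (b + 1) f then
    H h.choose \ revealed rk b f
  else ∅

lemma card_reference_le (H : ι → Finset (V × C)) (rk : T → ℕ) (R : ℕ → ℕ) (b : ℕ)
    (f : V → C × T) : #(reference H rk R b f) ≤ R b := by
  unfold reference
  split_ifs with h
  · exact h.choose_spec.1 b le_rfl
  · simp

/-- The minimal missing fragment `χ` of a stuck pair `(f, i)` is contained in the reference of the
colouring `f'` obtained by overwriting `f` with `χ` in round `b`. Thus `(f', χ)` together with the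
values of `f` on the vertices of `χ` determines `f`. -/
lemma exists_fragment_of_stuck (H : ι → Finset (V × C))
    (hH : ∀ i, ∀ p ∈ H i, ∀ q ∈ H i, p.1 = q.1 → p = q)
    (rk : T → ℕ) (R : ℕ → ℕ) (b : ℕ) (τ : T) (hτ : rk τ = b) {f : V → C × T} {i : ι}
    (h : Stuck H rk R b f i) :
    ∃ (f' : V → C × T) (χ : Finset (V × C)), χ ⊆ reference H rk R b f' ∧ R (b + 1) + 1 ≤ #χ ∧
      χ ⊆ H i ∧ ∀ v ∉ χ.image Prod.fst, f v = f' v := by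
  classical
  obtain ⟨hav, ⟨i₀, hi₀, hi₀'⟩, hng⟩ := h
  -- among the admissible completions by `H i`, choose the one with the least to add
  obtain ⟨i', ⟨hadm, hsub⟩, hmin⟩ : ∃ i', (Admissible H rk R b f i' ∧
      H i' ⊆ revealed rk (b + 1) f ∪ H i) ∧ ∀ j, Admissible H rk R b f j →
      H j ⊆ revealed rk (b + 1) f ∪ H i →
      #(H i' \ revealed rk (b + 1) f) ≤ #(H j \ revealed rk (b + 1) f) := by
    let P : Set ι := {i' | Admissible H rk R b f i' ∧ H i' ⊆ revealed rk (b + 1) f ∪ H i}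
    have hP : P.Nonempty := ⟨i₀, hi₀, hi₀'.trans
      (union_subset_union_left (revealed_mono rk f (Nat.le_succ b)))⟩
    refine ⟨Function.argminOn (fun j => #(H j \ revealed rk (b + 1) f)) P hP,
      Function.argminOn_mem _ _ hP, fun j hj hj' => ?_⟩
    exact Function.argminOn_le (fun j => #(H j \ revealed rk (b + 1) f)) P (a := j) ⟨hj, hj'⟩
  set χ := H i' \ revealed rk (b + 1) f with hχ
  have hχi : χ ⊆ H i := by
    intro p hp
    rw [hχ, mem_sdiff] at hp
    exact (mem_union.1 (hsub hp.1)).resolve_left hp.2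
  have hχfun : ∀ p ∈ χ, ∀ q ∈ χ, p.1 = q.1 → p = q := fun p hp q hq =>
    hH i p (hχi hp) q (hχi hq)
  -- overwrite `f` by `χ`, as if its vertices had been coloured in round `b`
  let f' : V → C × T := fun v => if h : ∃ c, (v, c) ∈ χ then (h.choose, τ) else f v
  have hf'χ : ∀ p ∈ χ, f' p.1 = (p.2, τ) := by
    intro p hp
    have h : ∃ c, (p.1, c) ∈ χ := ⟨p.2, hp⟩
    have h2 : (p.1, h.choose) = p := hχfun _ h.choose_spec p hp rfl
    simp only [f', dif_pos h]
    rw [← congrArg Prod.snd h2]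
  have hf'not : ∀ v, (¬ ∃ c, (v, c) ∈ χ) → f' v = f v := fun v hv => by
    simp only [f', dif_neg hv]
  have hrkχ : ∀ p ∈ χ, b + 1 ≤ rk (f p.1).2 := fun p hp => hav p (hχi hp)
  -- the earlier rounds are unchanged, because `f` colours the vertices of `χ` only later
  have hrev : ∀ a ≤ b, revealed rk a f' = revealed rk a f := by
    intro a ha
    ext p
    rw [mem_revealed, mem_revealed]
    by_cases hp : ∃ c, (p.1, c) ∈ χ
    · obtain ⟨c, hc⟩ := hp
      have h1 := hf'χ _ hc
      have h2 := hrkχ _ hc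
      simp only at h1 h2
      rw [h1]
      constructor
      · rintro ⟨-, h3⟩
        simp only at h3
        omega
      · rintro ⟨-, h3⟩
        omega
    · rw [hf'not _ hp]
  have hrev1 : revealed rk (b + 1) f' = revealed rk (b + 1) f ∪ χ := by
    ext p
    rw [mem_union, mem_revealed, mem_revealed]
    by_cases hp : ∃ c, (p.1, c) ∈ χ
    · obtain ⟨c, hc⟩ := hp
      have h1 := hf'χ _ hc
      have h2 := hrkχ _ hc
      simp only at h1 h2
      rw [h1]
      constructor
      · rintro ⟨h3, -⟩
        simp only at h3
        exact Or.inr (by rw [h3] at hc; exact hc)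
      · rintro (⟨-, h3⟩ | h3)
        · omega
        · have h4 := hχfun _ hc _ h3 rfl
          refine ⟨congrArg Prod.snd h4, ?_⟩
          simp only
          omega
    · rw [hf'not _ hp]
      constructor
      · exact Or.inl
      · rintro (h | h)
        · exact h
        · exact absurd ⟨p.2, h⟩ hp
  have hadm' : ∀ j, Admissible H rk R b f' j ↔ Admissible H rk R b f j := by
    intro j
    refine forall₂_congr fun a ha => ?_
    rw [hrev a ha]
  have hex : ∃ j, Admissible H rk R b f' j ∧ H j ⊆ revealed rk (b + 1) f' := by
    refine ⟨i', (hadm' _).2 hadm, ?_⟩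
    rw [hrev1]
    intro p hp
    by_cases h : p ∈ revealed rk (b + 1) f
    · exact mem_union_left _ h
    · exact mem_union_right _ (mem_sdiff.2 ⟨hp, h⟩)
  refine ⟨f', χ, ?_, ?_, hχi, ?_⟩
  · have hspec := hex.choose_spec
    set j := hex.choose with hj
    have href : reference H rk R b f' = H j \ revealed rk b f := by
      rw [reference, dif_pos hex, hrev b le_rfl]
    rw [hadm', hrev1] at hspec
    have hle := hmin j hspec.1 (hspec.2.trans (union_subset_union_right hχi))
    have hsub' : H j \ revealed rk (b + 1) f ⊆ χ := by
      intro p hp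
      rw [mem_sdiff] at hp
      exact (mem_union.1 (hspec.2 hp.1)).resolve_left hp.2
    -- the reference also completes `H i` with part of `χ`, so by minimality it needs all of `χ`
    have heq := eq_of_subset_of_card_le hsub' hle
    rw [href, ← heq]
    exact sdiff_subset_sdiff le_rfl (revealed_mono rk f (Nat.le_succ b))
  · by_contra hlt
    refine hng ⟨i', fun a ha => ?_, hsub⟩
    rcases Nat.lt_or_ge a (b + 1) with h | h
    · exact hadm a (Nat.lt_succ_iff.1 h)
    · obtain rfl : a = b + 1 := le_antisymm ha h
      rw [← hχ]
      omega
  · intro v hv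
    rw [hf'not v]
    rintro ⟨c, hc⟩
    exact hv (mem_image.2 ⟨(v, c), hc, rfl⟩)

/-- Forgetting the values of a function on `D` loses a factor of at most `card A ^ #D`. -/
lemma card_agree_off_le {A : Type*} [Fintype A] [DecidableEq A] (D : Finset V) (f' : V → A) :
    #{f : V → A | ∀ v ∉ D, f v = f' v} ≤ Fintype.card A ^ #D := by
  have h : ({f : V → A | ∀ v ∉ D, f v = f' v} : Finset (V → A)) ⊆
      Fintype.piFinset fun v => if v ∈ D then univ else {f' v} := by
    intro f hf
    rw [mem_filter] at hf
    rw [Fintype.mem_piFinset]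
    intro v
    split_ifs with hv
    · exact mem_univ _
    · exact mem_singleton.2 (hf.2 v hv)
  refine (card_le_card h).trans ?_
  rw [Fintype.card_piFinset]
  have : ∀ v, #(if v ∈ D then (univ : Finset A) else {f' v})
      = if v ∈ D then Fintype.card A else 1 := by
    intro v
    split_ifs <;> simp
  simp only [this]
  rw [prod_ite]
  simp

lemma card_filter_apply_mul {A : Type*} [Fintype A] [DecidableEq A] (v : V) (P : A → Prop)
    [DecidablePred P] :
    #{f : V → A | P (f v)} * Fintype.card A = Fintype.card (V → A) * #{a | P a} := by
  have h : ({f : V → A | P (f v)} : Finset (V → A)) =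
      Fintype.piFinset fun w => if w = v then ({a | P a} : Finset A) else univ := by
    ext f
    rw [mem_filter, Fintype.mem_piFinset]
    constructor
    · rintro ⟨-, h⟩ w
      split_ifs with hw
      · subst hw
        simpa using h
      · exact mem_univ _
    · intro h
      have := h v
      simp only [if_true, mem_filter, mem_univ, true_and] at this
      exact ⟨mem_univ _, this⟩
  have h2 : ∀ w, #(if w = v then ({a | P a} : Finset A) else univ) =
      if w = v then #{a | P a} else Fintype.card A := by
    intro w
    split_ifs <;> simp
  have h3 : Fintype.card (V → A) = Fintype.card A * ∏ w ∈ univ.erase v, Fintype.card A := by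
    rw [Fintype.card_fun, mul_prod_erase univ (fun _ => Fintype.card A) (mem_univ v)]
    simp
  rw [h, Fintype.card_piFinset, h3, ← mul_prod_erase univ _ (mem_univ v)]
  simp only [h2, if_true]
  rw [prod_congr rfl (g := fun _ => Fintype.card A)
    (fun w hw => if_neg (ne_of_mem_erase hw))]
  ring

open Classical in
/-- Counting the stuck pairs by their fragments. -/
lemma card_stuck_le [Fintype T] [Fintype ι] (H : ι → Finset (V × C))
    (hH : ∀ i, ∀ p ∈ H i, ∀ q ∈ H i, p.1 = q.1 → p = q)
    (rk : T → ℕ) (R : ℕ → ℕ) (b : ℕ) (τ : T) (hτ : rk τ = b) (q : ℕ) (hq : 1 ≤ q)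
    (hspread : ∀ Z : Finset (V × C),
      #{i | Z ⊆ H i} * (q * Fintype.card (C × T)) ^ #Z ≤ Fintype.card ι) :
    #{x : (V → C × T) × ι | Stuck H rk R b x.1 x.2} * q ^ (R (b + 1) + 1) ≤
      Fintype.card (V → C × T) * (2 ^ R b * Fintype.card ι) := by
  set F : (V → C × T) → Finset (Finset (V × C)) := fun f' =>
    {χ ∈ (reference H rk R b f').powerset | R (b + 1) + 1 ≤ #χ} with hF
  have hsub : ({x : (V → C × T) × ι | Stuck H rk R b x.1 x.2} : Finset _) ⊆
      univ.biUnion fun f' : V → C × T => (F f').biUnion fun χ =>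
        ({f : V → C × T | ∀ v ∉ χ.image Prod.fst, f v = f' v} : Finset (V → C × T)) ×ˢ
          ({i | χ ⊆ H i} : Finset ι) := by
    rintro ⟨f, i⟩ hx
    rw [mem_filter] at hx
    obtain ⟨f', χ, h1, h2, h3, h4⟩ := exists_fragment_of_stuck H hH rk R b τ hτ hx.2
    simp only [mem_biUnion, mem_product, mem_filter, mem_univ, true_and, hF, mem_powerset]
    exact ⟨f', χ, ⟨h1, h2⟩, h4, h3⟩
  have hone : ∀ f' : V → C × T, ∀ χ ∈ F f',
      #(({f : V → C × T | ∀ v ∉ χ.image Prod.fst, f v = f' v} : Finset (V → C × T)) ×ˢ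
          ({i | χ ⊆ H i} : Finset ι)) * q ^ (R (b + 1) + 1) ≤ Fintype.card ι := by
    intro f' χ hχ
    simp only [hF, mem_filter] at hχ
    rw [card_product]
    by_cases hA : Fintype.card (C × T) = 0
    · have hV : #χ ≠ 0 := by omega
      obtain ⟨p, hp⟩ := card_ne_zero.1 hV
      have : IsEmpty (C × T) := Fintype.card_eq_zero_iff.1 hA
      exact (this.false (f' p.1)).elim
    calc _ ≤ Fintype.card (C × T) ^ #χ * #{i | χ ⊆ H i} * q ^ #χ := by
          gcongr
          · exact (card_agree_off_le _ f').trans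
              (Nat.pow_le_pow_right (Nat.pos_of_ne_zero hA) card_image_le)
          · exact hχ.2
      _ = #{i | χ ⊆ H i} * (q * Fintype.card (C × T)) ^ #χ := by
          rw [mul_pow]; ring
      _ ≤ _ := hspread χ
  have hFcard : ∀ f', #(F f') ≤ 2 ^ R b := by
    intro f'
    calc #(F f') ≤ #(reference H rk R b f').powerset := card_filter_le _ _
      _ = 2 ^ #(reference H rk R b f') := card_powerset _
      _ ≤ 2 ^ R b := Nat.pow_le_pow_right (by norm_num) (card_reference_le H rk R b f')
  calc _ ≤ (∑ f' : V → C × T, ∑ χ ∈ F f',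
        #(({f : V → C × T | ∀ v ∉ χ.image Prod.fst, f v = f' v} : Finset (V → C × T)) ×ˢ
          ({i | χ ⊆ H i} : Finset ι))) * q ^ (R (b + 1) + 1) := by
        gcongr
        refine (card_le_card hsub).trans (card_biUnion_le.trans ?_)
        exact sum_le_sum fun f' _ => card_biUnion_le
    _ = ∑ f' : V → C × T, ∑ χ ∈ F f',
        #(({f : V → C × T | ∀ v ∉ χ.image Prod.fst, f v = f' v} : Finset (V → C × T)) ×ˢ
          ({i | χ ⊆ H i} : Finset ι)) * q ^ (R (b + 1) + 1) := by
        rw [sum_mul]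
        exact sum_congr rfl fun _ _ => sum_mul _ _ _
    _ ≤ ∑ f' : V → C × T, ∑ χ ∈ F f', Fintype.card ι :=
        sum_le_sum fun f' _ => sum_le_sum fun χ hχ => hone f' χ hχ
    _ ≤ ∑ f' : V → C × T, 2 ^ R b * Fintype.card ι := by
        refine sum_le_sum fun f' _ => ?_
        rw [sum_const, smul_eq_mul]
        exact Nat.mul_le_mul_right _ (hFcard f')
    _ = _ := by rw [sum_const, smul_eq_mul, card_univ]

lemma two_pow_mul_le (r s : ℕ) (hs : 1 ≤ s) : 2 ^ r * (4 * s) ≤ (8 * s) ^ (r / 2 + 1) := by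
  have h1 : 2 ^ r ≤ 2 * 8 ^ (r / 2) := by
    have : (8 : ℕ) = 2 ^ 3 := by norm_num
    rw [this, ← pow_mul, ← pow_succ']
    exact Nat.pow_le_pow_right (by norm_num) (by omega)
  calc 2 ^ r * (4 * s) ≤ 2 * 8 ^ (r / 2) * (4 * s) := Nat.mul_le_mul_right _ h1
    _ = 8 ^ (r / 2) * (8 * s) := by ring
    _ ≤ (8 * s) ^ (r / 2) * (8 * s) := by gcongr; omega
    _ = _ := by rw [pow_succ]

open Classical in
/-- The spread lemma for partial colourings: if `H` is a spread family of partial functions from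
vertices to colours, then a random colouring that keeps only the vertices with a tag of rank below
`s` contains a member of the family with probability at least one half. -/
lemma two_mul_card_not_subset_revealed_le [Fintype T] [Fintype ι] [Nonempty ι]
    (H : ι → Finset (V × C))
    (hH : ∀ i, ∀ p ∈ H i, ∀ q ∈ H i, p.1 = q.1 → p = q)
    (rk : T → ℕ) (j s : ℕ) (hs : 1 ≤ s) (hjs : j < 2 ^ s) (hHj : ∀ i, #(H i) ≤ j)
    (τ : ℕ → T) (hτ : ∀ b < s, rk (τ b) = b)
    (hrk : 4 * j * #{t | rk t < s} ≤ Fintype.card T)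
    (hspread : ∀ Z : Finset (V × C),
      #{i | Z ⊆ H i} * (8 * s * Fintype.card (C × T)) ^ #Z ≤ Fintype.card ι) :
    2 * #{f : V → C × T | ∀ i, ¬ H i ⊆ revealed rk s f} ≤ Fintype.card (V → C × T) := by
  set N := Fintype.card (V → C × T) with hN
  -- the missing part is to be halved in each round; each round and the avoidance of the coloured
  -- vertices may cost `1 / (4 s)` and `1 / 4` of all pairs
  set R : ℕ → ℕ := fun b => j / 2 ^ b with hR
  have hstuck : ∀ b ∈ range s,
      #{x : (V → C × T) × ι | Stuck H rk R b x.1 x.2} * (4 * s) ≤ N * Fintype.card ι := by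
    intro b hb
    have h1 := card_stuck_le H hH rk R b (τ b) (hτ b (mem_range.1 hb)) (8 * s) (by omega) hspread
    have h2 : R (b + 1) = R b / 2 := by
      simp only [hR, pow_succ, Nat.div_div_eq_div_mul]
    rw [h2] at h1
    have h3 := two_pow_mul_le (R b) s hs
    have h4 : 0 < 2 ^ R b := by positivity
    refine Nat.le_of_mul_le_mul_left ?_ h4
    calc 2 ^ R b * (#{x : (V → C × T) × ι | Stuck H rk R b x.1 x.2} * (4 * s))
        = #{x : (V → C × T) × ι | Stuck H rk R b x.1 x.2} * (2 ^ R b * (4 * s)) := by ring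
      _ ≤ #{x : (V → C × T) × ι | Stuck H rk R b x.1 x.2} * (8 * s) ^ (R b / 2 + 1) :=
          Nat.mul_le_mul_left _ h3
      _ ≤ N * (2 ^ R b * Fintype.card ι) := h1
      _ = _ := by ring
  have havoid : #{x : (V → C × T) × ι | ¬ Avoids H rk s x.1 x.2} * 4 ≤ N * Fintype.card ι := by
    have h1 : ∀ v : V, #{f : V → C × T | rk (f v).2 < s} * (4 * j) ≤ N := by
      intro v
      have h2 := card_filter_apply_mul v (fun a : C × T => rk a.2 < s)
      have h3 : #{a : C × T | rk a.2 < s} = Fintype.card C * #{t | rk t < s} := by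
        rw [← card_univ, ← card_product]
        congr 1
        ext a
        simp
      rw [h3] at h2
      by_cases hA : Fintype.card (C × T) = 0
      · have : IsEmpty (C × T) := Fintype.card_eq_zero_iff.1 hA
        have : IsEmpty (V → C × T) := ⟨fun f => this.false (f v)⟩
        simp
      refine Nat.le_of_mul_le_mul_right ?_ (Nat.pos_of_ne_zero hA)
      calc _ = (#{f : V → C × T | rk (f v).2 < s} * Fintype.card (C × T)) * (4 * j) := by ring
        _ = N * Fintype.card C * (4 * j * #{t | rk t < s}) := by rw [h2]; ring
        _ ≤ N * Fintype.card C * Fintype.card T := Nat.mul_le_mul_left _ hrk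
        _ = N * Fintype.card (C × T) := by rw [Fintype.card_prod]; ring
    have h2 : ({x : (V → C × T) × ι | ¬ Avoids H rk s x.1 x.2} : Finset _) ⊆
        univ.biUnion fun i : ι => (H i).biUnion fun p =>
          ({f : V → C × T | rk (f p.1).2 < s} : Finset _) ×ˢ {i} := by
      rintro ⟨f, i⟩ hx
      simp only [Avoids, mem_filter, mem_univ, true_and, not_forall, not_le] at hx
      obtain ⟨p, hp, hlt⟩ := hx
      simp only [mem_biUnion, mem_univ, true_and, mem_product, mem_filter, mem_singleton]
      exact ⟨i, p, hp, hlt, rfl⟩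
    have h3 : ∀ i, (∑ p ∈ H i, #(({f : V → C × T | rk (f p.1).2 < s} : Finset _) ×ˢ
        ({i} : Finset ι))) * 4 ≤ N := by
      intro i
      rcases (H i).eq_empty_or_nonempty with he | hne
      · simp [he]
      have hj : 0 < j := (card_pos.2 hne).trans_le (hHj i)
      refine Nat.le_of_mul_le_mul_right ?_ hj
      rw [mul_assoc, sum_mul]
      calc _ ≤ ∑ p ∈ H i, N := by
            refine sum_le_sum fun p _ => ?_
            rw [card_product, card_singleton, mul_one]
            exact h1 p.1
        _ ≤ N * j := by
            rw [sum_const, smul_eq_mul, mul_comm]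
            exact Nat.mul_le_mul_left _ (hHj i)
    calc _ ≤ (∑ i, ∑ p ∈ H i, #(({f : V → C × T | rk (f p.1).2 < s} : Finset _) ×ˢ
        ({i} : Finset ι))) * 4 := by
          gcongr
          refine (card_le_card h2).trans (card_biUnion_le.trans ?_)
          exact sum_le_sum fun i _ => card_biUnion_le
      _ ≤ ∑ i : ι, N := by
          rw [sum_mul]
          exact sum_le_sum fun i _ => h3 i
      _ = _ := by rw [sum_const, smul_eq_mul, card_univ, mul_comm]
  -- if nothing is fully revealed, every index meets a coloured vertex or is stuck in some round
  have hcover : ({f : V → C × T | ∀ i, ¬ H i ⊆ revealed rk s f} : Finset _) ×ˢ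
      (univ : Finset ι) ⊆ ({x : (V → C × T) × ι | ¬ Avoids H rk s x.1 x.2} : Finset _) ∪
        (range s).biUnion fun b => {x : (V → C × T) × ι | Stuck H rk R b x.1 x.2} := by
    rintro ⟨f, i⟩ hx
    simp only [mem_product, mem_filter, mem_univ, true_and, and_true] at hx
    simp only [mem_union, mem_filter, mem_univ, true_and, mem_biUnion, mem_range]
    by_contra! hcon
    obtain ⟨hav, hns⟩ := hcon
    have hgood : ∀ b ≤ s, Good H rk R b f i := by
      intro b
      induction b with
      | zero =>
        intro _
        refine ⟨i, fun a ha => ?_, subset_union_right⟩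
        obtain rfl : a = 0 := by omega
        simp only [hR, pow_zero, Nat.div_one]
        exact (card_le_card sdiff_subset).trans (hHj i)
      | succ b ih =>
        intro hb
        by_contra hng
        exact hns b (by omega) ⟨fun p hp => hb.trans (hav p hp), ih (by omega), hng⟩
    obtain ⟨i', hadm, -⟩ := hgood s le_rfl
    have h0 := hadm s le_rfl
    have hR0 : R s = 0 := Nat.div_eq_of_lt hjs
    rw [hR0, Nat.le_zero, card_eq_zero, sdiff_eq_empty_iff_subset] at h0
    exact hx i' h0
  have hcard : #{f : V → C × T | ∀ i, ¬ H i ⊆ revealed rk s f} * Fintype.card ι ≤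
      #{x : (V → C × T) × ι | ¬ Avoids H rk s x.1 x.2} +
        ∑ b ∈ range s, #{x : (V → C × T) × ι | Stuck H rk R b x.1 x.2} := by
    have := card_le_card hcover
    rw [card_product, card_univ] at this
    exact this.trans ((card_union_le _ _).trans (Nat.add_le_add_left card_biUnion_le _))
  have hsum : (∑ b ∈ range s, #{x : (V → C × T) × ι | Stuck H rk R b x.1 x.2}) * 4 ≤
      N * Fintype.card ι := by
    refine Nat.le_of_mul_le_mul_right ?_ hs
    rw [mul_assoc, sum_mul]
    calc _ ≤ ∑ b ∈ range s, N * Fintype.card ι := sum_le_sum hstuck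
      _ = _ := by rw [sum_const, smul_eq_mul, card_range, mul_comm]
  have hι : 0 < Fintype.card ι := Fintype.card_pos
  refine Nat.le_of_mul_le_mul_right ?_ hι
  nlinarith

end Spread

/-! ### Boosting the success probability -/

section Boosting

open Finset

variable {V C : Type*} [Fintype V] [DecidableEq V] [Fintype C]

open Classical in
lemma card_forall_fiber {A : Type*} [Fintype A] [DecidableEq A] (lam : V → A)
    (P : ∀ a, ({v // lam v = a} → C) → Prop) :
    #{c : V → C | ∀ a, P a fun v => c v} = ∏ a, #{d : {v // lam v = a} → C | P a d} := by
  rw [← Fintype.card_piFinset]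
  refine card_bij' (fun c _ a v => c v) (fun g _ v => g (lam v) ⟨v, rfl⟩) ?_ ?_ ?_ ?_
  · intro c hc
    simpa [Fintype.mem_piFinset] using hc
  · intro g hg
    simp only [Fintype.mem_piFinset, mem_filter, mem_univ, true_and] at hg ⊢
    intro a
    convert hg a with v
    obtain ⟨v, rfl⟩ := v
    rfl
  · intro c _
    rfl
  · intro g _
    funext a v
    obtain ⟨v, rfl⟩ := v
    rfl

open Classical in
/-- Events about the colours on the different parts of a partition are independent. -/
lemma card_forall_fiber_mul_pow {A : Type*} [Fintype A] [DecidableEq A] (lam : V → A)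
    (P : ∀ a, ({v // lam v = a} → C) → Prop) :
    (#{c : V → C | ∀ a, P a fun v => c v} : ℝ) * (Fintype.card (V → C) : ℝ) ^ Fintype.card A =
      Fintype.card (V → C) * ∏ a, (#{c : V → C | P a fun v => c v} : ℝ) := by
  set w : A → ℝ := fun a => (Fintype.card ({v // lam v = a} → C) : ℝ) with hw
  have htot : (Fintype.card (V → C) : ℝ) = ∏ a, w a := by
    have := card_forall_fiber (C := C) lam (fun _ _ => True)
    simp only [implies_true, filter_true, card_univ] at this
    rw [this]
    push_cast
    rfl
  have hone : ∀ a, (#{c : V → C | P a fun v => c v} : ℝ) =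
      #{d : {v // lam v = a} → C | P a d} * ∏ b ∈ univ.erase a, w b := by
    intro a
    have := card_forall_fiber (C := C) lam (fun b d => a = b → P b d)
    simp only [forall_eq'] at this
    rw [this, ← mul_prod_erase univ _ (mem_univ a)]
    push_cast
    congr 1
    · simp
    · refine prod_congr rfl fun b hb => ?_
      have hb' : a ≠ b := (ne_of_mem_erase hb).symm
      simp [hb', hw]
  have hprod : (∏ a, ∏ b ∈ univ.erase a, w b) * ∏ a, w a =
      (Fintype.card (V → C) : ℝ) ^ Fintype.card A := by
    rw [← prod_mul_distrib]
    rw [prod_congr rfl (g := fun _ => (Fintype.card (V → C) : ℝ))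
      (fun a _ => by rw [prod_erase_mul _ _ (mem_univ a), htot])]
    rw [prod_const, card_univ]
  simp only [hone]
  rw [prod_mul_distrib, card_forall_fiber]
  push_cast
  rw [← hprod, htot]
  ring

variable [DecidableEq C]

open Classical in
/-- If a family of partial functions `V → C` is spread, then all but an exponentially small
fraction of the colourings extend some member of the family. The vertices are split into `M`
random parts; on average each part alone succeeds with probability one half, so some fixed
partition makes the expected number of successful parts at least `M / 2`, and for a fixed partition
the parts are independent. -/
lemma card_not_subset_graph_le {ι : Type*} [Fintype ι] [Nonempty ι] [Nonempty C]
    (H : ι → Finset (V × C))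
    (hH : ∀ i, ∀ p ∈ H i, ∀ q ∈ H i, p.1 = q.1 → p = q)
    (j s M : ℕ) (hs : 1 ≤ s) (hjs : j < 2 ^ s) (hHj : ∀ i, #(H i) ≤ j)
    (hM0 : 0 < M) (hM : 4 * j ≤ M)
    (hspread : ∀ Z : Finset (V × C),
      #{i | Z ⊆ H i} * (8 * s ^ 2 * M * Fintype.card C) ^ #Z ≤ Fintype.card ι) :
    (#{c : V → C | ∀ i, ∃ p ∈ H i, c p.1 ≠ p.2} : ℝ) ≤
      Real.exp (-(M / 2 : ℝ)) * Fintype.card (V → C) := by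
  set T := Fin M × Fin s with hT
  set N := Fintype.card (V → C) with hN
  set Q := Fintype.card (V → T) with hQ
  have hN0 : (0 : ℝ) < N := by
    rw [hN]; exact_mod_cast Fintype.card_pos
  let E : Fin M → (V → T) → (V → C) → Prop := fun a g c =>
    ∃ i, ∀ p ∈ H i, c p.1 = p.2 ∧ (g p.1).1 = a
  have hblock : ∀ a : Fin M, Q * N ≤ 2 * #{x : (V → C) × (V → T) | E a x.2 x.1} := by
    intro a
    -- seen from block `a`, the vertices of the other blocks are never coloured
    let rk : T → ℕ := fun t => if t.1 = a then t.2 else s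
    have hcard : #{t : T | rk t < s} ≤ s := by
      have : ({t : T | rk t < s} : Finset T) ⊆ {a} ×ˢ univ := by
        rintro ⟨a', b⟩ h
        simp only [mem_filter, mem_univ, true_and, rk] at h
        refine mem_product.2 ⟨mem_singleton.2 ?_, mem_univ _⟩
        by_contra hne
        rw [if_neg hne] at h
        exact lt_irrefl _ h
      refine (card_le_card this).trans ?_
      simp
    have h1 := two_mul_card_not_subset_revealed_le (T := T) H hH rk j s hs hjs hHj
      (fun b => (a, if h : b < s then ⟨b, h⟩ else ⟨0, hs⟩))
      (fun b hb => by simp [rk, hb])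
      (by
        rw [Fintype.card_prod, Fintype.card_fin, Fintype.card_fin]
        exact Nat.mul_le_mul hM hcard)
      (fun Z => by
        convert hspread Z using 3
        rw [Fintype.card_prod, Fintype.card_prod, Fintype.card_fin, Fintype.card_fin]
        ring)
    have h2 : #{x : (V → C) × (V → T) | E a x.2 x.1} =
        #{f : V → C × T | ¬ ∀ i, ¬ H i ⊆ revealed rk s f} := by
      refine card_equiv (Equiv.arrowProdEquivProdArrow V (fun _ => C) (fun _ => T)).symm ?_
      rintro ⟨c, g⟩
      simp only [mem_filter, mem_univ, true_and, not_forall, not_not, E]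
      refine exists_congr fun i => ?_
      refine forall₂_congr fun p _ => ?_
      rw [mem_revealed]
      simp only [Equiv.arrowProdEquivProdArrow, Equiv.coe_fn_symm_mk, rk]
      refine and_congr_right fun _ => ?_
      split_ifs with h
      · simp [h]
      · simp [h]
    have h3 := card_filter_add_card_filter_not (s := (univ : Finset (V → C × T)))
      (fun f => ∀ i, ¬ H i ⊆ revealed rk s f)
    have h4 : Fintype.card (V → C × T) = Q * N := by
      rw [Fintype.card_congr (Equiv.arrowProdEquivProdArrow V (fun _ => C) (fun _ => T)),
        Fintype.card_prod, mul_comm]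
    rw [card_univ] at h3
    omega
  obtain ⟨g, hg⟩ : ∃ g : V → T, M * N ≤ ∑ a : Fin M, 2 * #{c : V → C | E a g c} := by
    by_contra! hcon
    have : Nonempty (V → T) := ⟨fun _ => (⟨0, hM0⟩, ⟨0, hs⟩)⟩
    have h1 : ∑ g : V → T, ∑ a : Fin M, 2 * #{c : V → C | E a g c} < ∑ g : V → T, M * N :=
      sum_lt_sum_of_nonempty univ_nonempty fun g _ => hcon g
    rw [sum_comm, sum_const, smul_eq_mul, card_univ] at h1
    have h2 : ∀ a : Fin M, ∑ g : V → T, 2 * #{c : V → C | E a g c} =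
        2 * #{x : (V → C) × (V → T) | E a x.2 x.1} := by
      intro a
      rw [← mul_sum]
      congr 1
      simp only [card_filter]
      rw [Fintype.sum_prod_type, sum_comm]
    simp only [h2] at h1
    have h3 : ∑ a : Fin M, Q * N ≤ ∑ a : Fin M, 2 * #{x : (V → C) × (V → T) | E a x.2 x.1} :=
      sum_le_sum fun a _ => hblock a
    rw [sum_const, smul_eq_mul, card_univ, Fintype.card_fin] at h3
    have h4 : M * (Q * N) = Q * (M * N) := by ring
    rw [← hQ] at h1
    omega
  set lam : V → Fin M := fun v => (g v).1 with hlam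
  obtain ⟨P, hPE⟩ : ∃ P : ∀ a : Fin M, ({v // lam v = a} → C) → Prop,
      ∀ a (c : V → C), (P a fun v => c v) ↔ ¬ E a g c := by
    refine ⟨fun a d => ¬ ∃ i, ∀ p ∈ H i, ∃ h : lam p.1 = a, d ⟨p.1, h⟩ = p.2, fun a c => ?_⟩
    refine not_congr (exists_congr fun i => forall₂_congr fun p _ => ?_)
    simp only [exists_prop]
    exact and_comm
  set q : Fin M → ℝ := fun a => (#{c : V → C | E a g c} : ℝ) / N with hq
  have hPq : ∀ a, (#{c : V → C | P a fun v => c v} : ℝ) = N * (1 - q a) := by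
    intro a
    have h3 := card_filter_add_card_filter_not (s := (univ : Finset (V → C))) (fun c => E a g c)
    rw [card_univ, ← hN] at h3
    simp only [hPE, hq]
    rw [mul_sub, mul_div_cancel₀ _ hN0.ne', mul_one, ← h3]
    push_cast
    ring
  have hq1 : ∀ a, 0 ≤ 1 - q a := by
    intro a
    have : 0 ≤ (N : ℝ) * (1 - q a) := by rw [← hPq]; positivity
    exact nonneg_of_mul_nonneg_right this hN0
  have hqsum : (M : ℝ) / 2 ≤ ∑ a, q a := by
    have h : (M * N : ℝ) ≤ ∑ a : Fin M, 2 * (#{c : V → C | E a g c} : ℝ) := by exact_mod_cast hg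
    rw [← mul_sum] at h
    simp only [hq]
    rw [← sum_div, le_div_iff₀ hN0]
    linarith
  have hind := card_forall_fiber_mul_pow lam P
  rw [Fintype.card_fin, ← hN] at hind
  simp only [hPq, prod_mul_distrib, prod_const, card_univ, Fintype.card_fin] at hind
  have hcount : (#{c : V → C | ∀ a, P a fun v => c v} : ℝ) = N * ∏ a, (1 - q a) := by
    have h : (N : ℝ) ^ M ≠ 0 := by positivity
    refine mul_right_cancel₀ h (Eq.trans ?_ (hind.trans (by ring)))
    congr!
  have hprod : ∏ a, (1 - q a) ≤ Real.exp (-(M / 2 : ℝ)) := by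
    calc ∏ a, (1 - q a) ≤ ∏ a, Real.exp (-q a) :=
          prod_le_prod (fun a _ => hq1 a) fun a _ => by
            have := Real.add_one_le_exp (-q a); linarith
      _ = Real.exp (-∑ a, q a) := by rw [← Real.exp_sum, sum_neg_distrib]
      _ ≤ _ := Real.exp_le_exp.2 (by linarith)
  calc (#{c : V → C | ∀ i, ∃ p ∈ H i, c p.1 ≠ p.2} : ℝ)
      ≤ #{c : V → C | ∀ a, P a fun v => c v} := by
        norm_cast
        refine card_le_card fun c hc => ?_
        simp only [mem_filter, mem_univ, true_and, hPE] at hc ⊢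
        rintro a ⟨i, hi⟩
        obtain ⟨p, hp, hne⟩ := hc i
        exact hne (hi p hp).1
    _ = N * ∏ a, (1 - q a) := hcount
    _ ≤ N * Real.exp (-(M / 2 : ℝ)) := by gcongr
    _ = _ := mul_comm _ _

end Boosting

/-! ### Sunflowers for random colourings -/

section Sunflower

open Finset

/-- Prescribing one more value of an injection `X → D` costs a factor of at least
`card D - card X`. -/
lemma card_embedding_extending_insert_le {X D : Type*} [Fintype X] [Fintype D]
    [DecidableEq X] [DecidableEq D] (Z : Finset (X × D)) (p : X × D)
    (hp : p ∉ Z) :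
    #{σ : X ↪ D | ∀ q ∈ insert p Z, σ q.1 = q.2} * (Fintype.card D - Fintype.card X) ≤
      #{σ : X ↪ D | ∀ q ∈ Z, σ q.1 = q.2} := by
  have key := card_mul_le_card_mul
    (s := ({σ : X ↪ D | ∀ q ∈ insert p Z, σ q.1 = q.2} : Finset (X ↪ D)))
    (t := ({σ : X ↪ D | ∀ q ∈ Z, σ q.1 = q.2} : Finset (X ↪ D)))
    (fun σ σ' => ∀ x, x ≠ p.1 → σ' x = σ x)
    (m := Fintype.card D - Fintype.card X) (n := 1) ?_ ?_
  · simpa using key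
  · intro σ hσ
    simp only [mem_filter, mem_univ, true_and, mem_insert, forall_eq_or_imp] at hσ
    have hfree : #((univ.image σ)ᶜ) = Fintype.card D - Fintype.card X := by
      rw [card_compl, card_image_of_injective _ σ.injective, card_univ]
    rw [← hfree]
    have hset : ∀ d ∈ (univ.image σ)ᶜ, ∀ x, x ≠ p.1 → σ.setValue p.1 d x = σ x := by
      intro d hd x hx
      refine Function.Embedding.setValue_eq_of_ne hx ?_
      intro hxd
      simp only [mem_compl, mem_image, mem_univ, true_and, not_exists] at hd
      exact hd x hxd
    refine card_le_card_of_injOn (fun d => σ.setValue p.1 d) ?_ ?_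
    · intro d hd
      simp only [bipartiteAbove, coe_filter, mem_filter, mem_univ, true_and, Set.mem_ofPred_eq]
      refine ⟨fun q hq => ?_, hset d hd⟩
      have hqp : q.1 ≠ p.1 := by
        intro h
        apply hp
        have : q = p := Prod.ext h (by rw [← hσ.1, ← hσ.2 q hq, h])
        rwa [← this]
      rw [hset d hd _ hqp, hσ.2 q hq]
    · intro d _ d' _ h
      have := DFunLike.congr_fun h p.1
      simpa using this
  · intro σ' _
    rw [card_le_one]
    intro σ hσ τ hτ
    simp only [bipartiteBelow, mem_filter, mem_univ, true_and, mem_insert,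
      forall_eq_or_imp] at hσ hτ
    ext x
    by_cases hx : x = p.1
    · rw [hx, hσ.1.1, hτ.1.1]
    · rw [← hσ.2 x hx, hτ.2 x hx]

lemma card_embedding_extending_le {X D : Type*} [Fintype X] [Fintype D] [DecidableEq X]
    [DecidableEq D] (Z : Finset (X × D)) :
    #{σ : X ↪ D | ∀ q ∈ Z, σ q.1 = q.2} * (Fintype.card D - Fintype.card X) ^ #Z ≤
      Fintype.card (X ↪ D) := by
  induction Z using Finset.induction_on with
  | empty => simp
  | insert p Z hp ih =>
    rw [card_insert_of_notMem hp, pow_succ']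
    calc _ = #{σ : X ↪ D | ∀ q ∈ insert p Z, σ q.1 = q.2} *
            (Fintype.card D - Fintype.card X) * (Fintype.card D - Fintype.card X) ^ #Z := by
          rw [mul_assoc]
      _ ≤ _ := Nat.mul_le_mul_right _ (card_embedding_extending_insert_le Z p hp)
      _ ≤ _ := ih

variable {V C : Type*} [Fintype V] [DecidableEq V] [Fintype C]

/-- Resampling the colours on `Y` independently does not change the distribution of a uniformly
random colouring. -/
lemma sum_card_piecewise (Y : Finset V) (P : (V → C) → Prop) [DecidablePred P] :
    ∑ h : V → C, #{c : V → C | P (Y.piecewise h c)} =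
      Fintype.card (V → C) * #{c : V → C | P c} := by
  have h1 : ∑ h : V → C, #{c : V → C | P (Y.piecewise h c)} =
      #{x : (V → C) × (V → C) | P (Y.piecewise x.1 x.2)} := by
    simp only [card_filter]
    rw [Fintype.sum_prod_type]
  have h2 : #{x : (V → C) × (V → C) | P (Y.piecewise x.1 x.2)} =
      #{x : (V → C) × (V → C) | P x.1} := by
    have hinv : ∀ x : (V → C) × (V → C), Y.piecewise (Y.piecewise x.1 x.2)
        (Y.piecewise x.2 x.1) = x.1 ∧ Y.piecewise (Y.piecewise x.2 x.1)
        (Y.piecewise x.1 x.2) = x.2 := by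
      intro x
      constructor <;>
      · funext v
        by_cases hv : v ∈ Y <;> simp [hv]
    refine card_bij' (fun x _ => (Y.piecewise x.1 x.2, Y.piecewise x.2 x.1))
      (fun x _ => (Y.piecewise x.1 x.2, Y.piecewise x.2 x.1)) ?_ ?_ ?_ ?_
    · intro x hx
      simpa using hx
    · intro x hx
      simpa [(hinv x).1] using hx
    · intro x _
      exact Prod.ext (hinv x).1 (hinv x).2
    · intro x _
      exact Prod.ext (hinv x).1 (hinv x).2
  have h3 : ({x : (V → C) × (V → C) | P x.1} : Finset _) =
      ({c : V → C | P c} : Finset _) ×ˢ univ := by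
    ext x
    simp
  rw [h1, h2, h3, card_product, card_univ, mul_comm]

variable [DecidableEq C]

open Classical in
/-- If the sets of `F` containing `Y` are spread outside `Y`, then almost every colouring is
injective, with values in the large set `D`, on `B \ Y` for some `B ∈ F` containing `Y`. The
family to which the spread property is transferred consists of all injections `B \ Y → D`. -/
lemma card_not_injOn_sdiff_le [Nonempty C] (F : Finset (Finset V)) (Y : Finset V) (D : Finset C)
    (j s M r : ℕ) (hs : 1 ≤ s) (hjs : j < 2 ^ s) (hM0 : 0 < M) (hM : 4 * j ≤ M)
    (hF : ∀ B ∈ F, #B = j) (hne : ∃ B ∈ F, Y ⊆ B)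
    (hlink : ∀ W, Disjoint Y W → #{B ∈ F | Y ∪ W ⊆ B} * r ^ #W ≤
      #{B ∈ F | Y ⊆ B})
    (hr : 8 * s ^ 2 * M * Fintype.card C ≤ r * (#D - (j - #Y)))
    (hD : j - #Y ≤ #D) :
    (#{c : V → C | ∀ B ∈ F, Y ⊆ B →
        ¬ (Set.InjOn c (B \ Y : Finset V) ∧ ∀ v ∈ B \ Y, c v ∈ D)} : ℝ) ≤
      Real.exp (-(M / 2 : ℝ)) * Fintype.card (V → C) := by
  let ι := Σ B : {B // B ∈ F ∧ Y ⊆ B}, ((B.1 \ Y : Finset V) ↪ D)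
  let H : ι → Finset (V × C) := fun i => univ.image fun v => (v.1, (i.2 v).1)
  have hmem : ∀ (i : ι) (p : V × C), p ∈ H i ↔ ∃ v, v.1 = p.1 ∧ (i.2 v).1 = p.2 := by
    intro i p
    simp only [H, mem_image, mem_univ, true_and, Prod.ext_iff]
  have hfun : ∀ i, ∀ p ∈ H i, ∀ q ∈ H i, p.1 = q.1 → p = q := by
    intro i p hp q hq hpq
    obtain ⟨v, hv1, hv2⟩ := (hmem i p).1 hp
    obtain ⟨w, hw1, hw2⟩ := (hmem i q).1 hq
    have hvw : v = w := Subtype.ext (by rw [hv1, hw1, hpq])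
    exact Prod.ext hpq (by rw [← hv2, ← hw2, hvw])
  have hBcard : ∀ B : {B // B ∈ F ∧ Y ⊆ B}, Fintype.card (B.1 \ Y : Finset V) = j - #Y := by
    intro B
    rw [Fintype.card_coe, card_sdiff_of_subset B.2.2, hF _ B.2.1]
  have hcardH : ∀ i, #(H i) ≤ j := by
    intro i
    refine card_image_le.trans ?_
    rw [card_univ, hBcard]
    omega
  have : Nonempty ι := by
    obtain ⟨B, hB, hYB⟩ := hne
    have : Nonempty ((B \ Y : Finset V) ↪ D) :=
      Function.Embedding.nonempty_of_card_le (by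
        rw [hBcard ⟨B, hB, hYB⟩, Fintype.card_coe]; exact hD)
    exact ⟨⟨⟨B, hB, hYB⟩, this.some⟩⟩
  set e := (#D).descFactorial (j - #Y) with he
  have hEmb : ∀ B : {B // B ∈ F ∧ Y ⊆ B}, Fintype.card ((B.1 \ Y : Finset V) ↪ D) = e := by
    intro B
    rw [Fintype.card_embedding_eq, hBcard, Fintype.card_coe]
  have hι : Fintype.card ι = #{B ∈ F | Y ⊆ B} * e := by
    rw [Fintype.card_sigma]
    simp only [hEmb]
    rw [sum_const, smul_eq_mul, card_univ, Fintype.card_subtype]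
    congr 2
    ext B
    simp
  have hspread : ∀ Z : Finset (V × C),
      #{i | Z ⊆ H i} * (8 * s ^ 2 * M * Fintype.card C) ^ #Z ≤ Fintype.card ι := by
    intro Z
    rcases ({i | Z ⊆ H i} : Finset ι).eq_empty_or_nonempty with h0 | ⟨i₀, hi₀⟩
    · rw [h0, card_empty, zero_mul]
      exact Nat.zero_le _
    have hZ₀ : Z ⊆ H i₀ := (mem_filter.1 hi₀).2
    set W := Z.image Prod.fst with hW
    have hWcard : #W = #Z := card_image_of_injOn fun p hp q hq h =>
      hfun i₀ p (hZ₀ hp) q (hZ₀ hq) h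
    have hYW : Disjoint Y W := by
      rw [disjoint_right]
      intro v hv
      obtain ⟨p, hp, rfl⟩ := mem_image.1 hv
      obtain ⟨w, hw, -⟩ := (hmem _ p).1 (hZ₀ hp)
      rw [← hw]
      exact (mem_sdiff.1 w.2).2
    have hfib : ∀ B : {B // B ∈ F ∧ Y ⊆ B},
        #{σ : (B.1 \ Y : Finset V) ↪ D | Z ⊆ H ⟨B, σ⟩} * (#D - (j - #Y)) ^ #Z ≤
          if Y ∪ W ⊆ B.1 then e else 0 := by
      intro B
      rcases ({σ : (B.1 \ Y : Finset V) ↪ D | Z ⊆ H ⟨B, σ⟩} : Finset _).eq_empty_or_nonempty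
        with h1 | ⟨σ₁, hσ₁⟩
      · rw [h1, card_empty, zero_mul]
        exact Nat.zero_le _
      have hZ₁ : Z ⊆ H ⟨B, σ₁⟩ := (mem_filter.1 hσ₁).2
      have hsub : Y ∪ W ⊆ B.1 := by
        refine union_subset B.2.2 fun v hv => ?_
        obtain ⟨p, hp, rfl⟩ := mem_image.1 hv
        obtain ⟨w, hw, -⟩ := (hmem _ p).1 (hZ₁ hp)
        rw [← hw]
        exact (mem_sdiff.1 w.2).1
      rw [if_pos hsub]
      let Z' : Finset ((B.1 \ Y : Finset V) × D) := {q | (q.1.1, q.2.1) ∈ Z}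
      have hZ' : #Z ≤ #Z' := by
        refine (card_le_card (t := Z'.image fun q => (q.1.1, q.2.1)) fun p hp => ?_).trans
          card_image_le
        obtain ⟨w, hw1, hw2⟩ := (hmem _ p).1 (hZ₁ hp)
        have hpe : (w.1, (σ₁ w).1) = p := Prod.ext hw1 hw2
        refine mem_image.2 ⟨(w, σ₁ w), ?_, hpe⟩
        rw [mem_filter]
        exact ⟨mem_univ _, by simpa only [hpe] using hp⟩
      have h2 := card_embedding_extending_le Z'
      rw [hEmb, hBcard, Fintype.card_coe] at h2
      by_cases hx : #D - (j - #Y) = 0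
      · rw [hx] at h2 ⊢
        rcases Nat.eq_zero_or_pos (#Z) with hz | hz
        · rw [hz, pow_zero, mul_one]
          calc _ ≤ Fintype.card ((B.1 \ Y : Finset V) ↪ D) := card_le_univ _
            _ = e := hEmb B
        · rw [zero_pow hz.ne']
          simp
      refine le_trans (Nat.mul_le_mul (card_le_card fun σ hσ => ?_)
        (Nat.pow_le_pow_right (Nat.pos_of_ne_zero hx) hZ')) h2
      rw [mem_filter] at hσ ⊢
      refine ⟨mem_univ _, fun q hq => ?_⟩
      obtain ⟨w, hw1, hw2⟩ := (hmem _ _).1 (hσ.2 (mem_filter.1 hq).2)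
      have : w = q.1 := Subtype.ext hw1
      rw [← this]
      exact Subtype.ext hw2
    have hcount : #{i | Z ⊆ H i} = ∑ B : {B // B ∈ F ∧ Y ⊆ B},
        #{σ : (B.1 \ Y : Finset V) ↪ D | Z ⊆ H ⟨B, σ⟩} := by
      rw [← card_sigma]
      congr 1
      ext ⟨B, σ⟩
      rw [mem_filter, mem_sigma, mem_filter]
      simp only [mem_univ, true_and]
    calc #{i | Z ⊆ H i} * (8 * s ^ 2 * M * Fintype.card C) ^ #Z
        ≤ #{i | Z ⊆ H i} * (r * (#D - (j - #Y))) ^ #Z := by gcongr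
      _ = (∑ B : {B // B ∈ F ∧ Y ⊆ B},
          #{σ : (B.1 \ Y : Finset V) ↪ D | Z ⊆ H ⟨B, σ⟩} * (#D - (j - #Y)) ^ #Z) * r ^ #Z := by
          rw [hcount, mul_pow, ← sum_mul]; ring
      _ ≤ (∑ B : {B // B ∈ F ∧ Y ⊆ B}, if Y ∪ W ⊆ B.1 then e else 0) * r ^ #Z := by
          gcongr with B
          exact hfib B
      _ = #{B ∈ F | Y ∪ W ⊆ B} * r ^ #W * e := by
          rw [hWcard, ← sum_filter, sum_const, smul_eq_mul]
          have : #{B : {B // B ∈ F ∧ Y ⊆ B} | Y ∪ W ⊆ B.1} = #{B ∈ F | Y ∪ W ⊆ B} := by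
            refine card_bij (fun B _ => B.1) ?_ ?_ ?_
            · intro B hB
              exact mem_filter.2 ⟨B.2.1, (mem_filter.1 hB).2⟩
            · intro B _ B' _ h
              exact Subtype.ext h
            · intro B hB
              rw [mem_filter] at hB
              exact ⟨⟨B, hB.1, subset_union_left.trans hB.2⟩,
                mem_filter.2 ⟨mem_univ _, hB.2⟩, rfl⟩
          rw [this]
          ring
      _ ≤ #{B ∈ F | Y ⊆ B} * e := Nat.mul_le_mul_right _ (hlink W hYW)
      _ = _ := hι.symm
  have key := card_not_subset_graph_le H hfun j s M hs hjs hcardH hM0 hM hspread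
  refine le_trans ?_ key
  norm_cast
  refine card_le_card fun c hc => ?_
  rw [mem_filter] at hc ⊢
  refine ⟨mem_univ _, ?_⟩
  rintro ⟨B, σ⟩
  by_contra! hcon
  have hcv : ∀ v (hv : v ∈ B.1 \ Y), c v = (σ ⟨v, hv⟩).1 := fun v hv =>
    hcon (v, (σ ⟨v, hv⟩).1) ((hmem _ _).2 ⟨⟨v, hv⟩, rfl, rfl⟩)
  refine hc.2 B.1 B.2.1 B.2.2 ⟨?_, ?_⟩
  · intro v hv w hw hvw
    rw [hcv v hv, hcv w hw] at hvw
    exact congrArg Subtype.val (σ.injective (Subtype.ext hvw))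
  · intro v hv
    rw [hcv v hv]
    exact (σ ⟨v, hv⟩).2

open Classical in
/-- Any family of more than `r ^ j` sets of size `j` has a core `Y` of size less than `j` such that
a random colouring is unlikely to be injective on `Y` but on no member of the family. -/
lemma exists_sunflower_core [Nonempty C] (F : Finset (Finset V)) (j s M : ℕ) (hs : 1 ≤ s)
    (hjs : j < 2 ^ s) (hM0 : 0 < M) (hM : 4 * j ≤ M) (hF : ∀ B ∈ F, #B = j)
    (hC : 2 * j ≤ Fintype.card C) (hcard : (16 * s ^ 2 * M) ^ j < #F) :
    ∃ Y, #Y < j ∧ (∃ B ∈ F, Y ⊆ B) ∧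
      (#{c : V → C | Set.InjOn c Y ∧ ∀ B ∈ F, ¬ Set.InjOn c B} : ℝ) ≤
        Real.exp (-(M / 2 : ℝ)) * Fintype.card (V → C) := by
  set r := 16 * s ^ 2 * M with hr
  -- the core is a largest set that many members contain, so their remainders are spread
  have hr0 : 0 < r := by positivity
  let P : Finset (Finset V) := {Y | #F ≤ r ^ #Y * #{B ∈ F | Y ⊆ B} ∧ ∃ B ∈ F, Y ⊆ B}
  have hFne : F.Nonempty := card_pos.1 (by omega)
  have hPne : P.Nonempty := by
    obtain ⟨B, hB⟩ := hFne
    refine ⟨∅, mem_filter.2 ⟨mem_univ _, ?_, B, hB, empty_subset _⟩⟩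
    simp
  obtain ⟨Y, hYP, hmax⟩ := exists_max_image P card hPne
  obtain ⟨hYF, B₀, hB₀, hYB₀⟩ := (mem_filter.1 hYP).2
  have hYj : #Y < j := by
    refine lt_of_le_of_ne ((card_le_card hYB₀).trans (hF _ hB₀).le) fun hYj => ?_
    have h1 : #{B ∈ F | Y ⊆ B} ≤ 1 := by
      rw [card_le_one]
      have : ∀ B ∈ ({B ∈ F | Y ⊆ B} : Finset _), B = Y := by
        intro B hB
        rw [mem_filter] at hB
        exact (eq_of_subset_of_card_le hB.2 (by rw [hF _ hB.1, hYj])).symm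
      intro B hB B' hB'
      rw [this B hB, this B' hB']
    have h2 : r ^ #Y * #{B ∈ F | Y ⊆ B} ≤ r ^ #Y * 1 := Nat.mul_le_mul_left _ h1
    rw [hYj] at hYF h2
    omega
  have hlink : ∀ W, Disjoint Y W → #{B ∈ F | Y ∪ W ⊆ B} * r ^ #W ≤ #{B ∈ F | Y ⊆ B} := by
    intro W hW
    rcases W.eq_empty_or_nonempty with rfl | hWne
    · simp
    rcases ({B ∈ F | Y ∪ W ⊆ B} : Finset _).eq_empty_or_nonempty with h0 | ⟨B, hB⟩
    · rw [h0, card_empty, zero_mul]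
      exact Nat.zero_le _
    have hWpos := card_pos.2 hWne
    have hcYW : #(Y ∪ W) = #Y + #W := card_union_of_disjoint hW
    have hnot : Y ∪ W ∉ P := fun h => by
      have := hmax _ h
      omega
    rw [mem_filter] at hB
    have hlt : r ^ #(Y ∪ W) * #{B ∈ F | Y ∪ W ⊆ B} < #F := by
      by_contra! hge
      exact hnot (mem_filter.2 ⟨mem_univ _, hge, B, hB.1, hB.2⟩)
    have h3 := hlt.le.trans hYF
    rw [hcYW, pow_add] at h3
    have h4 : 0 < r ^ #Y := by positivity
    refine Nat.le_of_mul_le_mul_left ?_ h4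
    calc _ = r ^ #Y * r ^ #W * #{B ∈ F | Y ∪ W ⊆ B} := by ring
      _ ≤ _ := h3
  refine ⟨Y, hYj, ⟨B₀, hB₀, hYB₀⟩, ?_⟩
  set N : ℝ := ((Fintype.card (V → C) : ℕ) : ℝ) with hN
  have hN0 : 0 < N := by
    rw [hN]
    exact_mod_cast Fintype.card_pos
  -- with the colours on `Y` fixed by `h`, the others must be injective and avoid those of `Y`
  have hfix : ∀ h : V → C, (#{c : V → C | Set.InjOn (Y.piecewise h c) Y ∧
      ∀ B ∈ F, ¬ Set.InjOn (Y.piecewise h c) B} : ℝ) ≤ Real.exp (-(M / 2 : ℝ)) * N := by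
    intro h
    set D : Finset C := (Y.image h)ᶜ with hD
    have hDcard : Fintype.card C - #Y ≤ #D := by
      rw [hD, card_compl]
      exact Nat.sub_le_sub_left card_image_le _
    refine le_trans ?_ (card_not_injOn_sdiff_le F Y D j s M r hs hjs hM0 hM hF
      ⟨B₀, hB₀, hYB₀⟩ hlink ?_ (by omega))
    · norm_cast
      refine card_le_card fun c hc => ?_
      rw [mem_filter] at hc ⊢
      obtain ⟨-, hcY, hcB⟩ := hc
      refine ⟨mem_univ _, fun B hB hYB hcon => hcB B hB ?_⟩
      have hin : ∀ v ∈ Y, Y.piecewise h c v = h v := fun v hv => piecewise_eq_of_mem _ _ _ hv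
      have hout : ∀ v ∉ Y, Y.piecewise h c v = c v := fun v hv =>
        piecewise_eq_of_notMem _ _ _ hv
      have hcross : ∀ v ∈ B, ∀ w ∈ B, v ∈ Y → w ∉ Y → h v ≠ c w := by
        intro v _ w hw hvY hwY heq
        have := hcon.2 w (mem_sdiff.2 ⟨hw, hwY⟩)
        rw [hD, mem_compl, ← heq] at this
        exact this (mem_image_of_mem _ hvY)
      intro v hv w hw hvw
      by_cases hvY : v ∈ Y <;> by_cases hwY : w ∈ Y
      · exact hcY hvY hwY hvw
      · rw [hin v hvY, hout w hwY] at hvw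
        exact (hcross v hv w hw hvY hwY hvw).elim
      · rw [hout v hvY, hin w hwY] at hvw
        exact (hcross w hw v hv hwY hvY hvw.symm).elim
      · rw [hout v hvY, hout w hwY] at hvw
        exact hcon.1 (by simp [hvY, mem_coe.1 hv]) (by simp [hwY, mem_coe.1 hw]) hvw
    · have h1 : Fintype.card C ≤ 2 * (#D - (j - #Y)) := by omega
      calc 8 * s ^ 2 * M * Fintype.card C ≤ 8 * s ^ 2 * M * (2 * (#D - (j - #Y))) :=
            Nat.mul_le_mul_left _ h1
        _ = _ := by rw [hr]; ring
  have hsum := sum_card_piecewise Y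
    (fun c : V → C => Set.InjOn c Y ∧ ∀ B ∈ F, ¬ Set.InjOn c B)
  have hsum' : N * (#{c : V → C | Set.InjOn c Y ∧ ∀ B ∈ F, ¬ Set.InjOn c B} : ℝ) ≤
      N * (Real.exp (-(M / 2 : ℝ)) * N) := by
    rw [hN, ← Nat.cast_mul, ← hsum]
    push_cast
    refine (sum_le_sum fun h _ => hfix h).trans ?_
    rw [sum_const, nsmul_eq_mul, card_univ]
  exact le_of_mul_le_mul_left hsum' hN0

end Sunflower

/-! ### Closed families as approximators -/

section Approximators

open Finset

variable {V C : Type*}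

/-- The family `F`, read as a disjunction of clique indicators, accepts the clique with vertex
set `X`. -/
def AcceptsSet (F : Finset (Finset V)) (X : Finset V) : Prop :=
  ∃ A ∈ F, A ⊆ X

/-- The family `F`, read as a disjunction of clique indicators, accepts the complete multipartite
graph whose parts are the colour classes of `c`. -/
def AcceptsColoring (F : Finset (Finset V)) (c : V → C) : Prop :=
  ∃ A ∈ F, Set.InjOn c A

lemma AcceptsSet.mono {F F' : Finset (Finset V)} (h : F ⊆ F') {X : Finset V}
    (hX : AcceptsSet F X) : AcceptsSet F' X :=
  let ⟨A, hA, hXA⟩ := hX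
  ⟨A, h hA, hXA⟩

variable [DecidableEq V]

/-- The unions of a member of `F₁` and a member of `F₂` that have at most `l` elements. -/
def meetFamily (l : ℕ) (F₁ F₂ : Finset (Finset V)) : Finset (Finset V) :=
  {D ∈ image₂ (· ∪ ·) F₁ F₂ | #D ≤ l}

lemma AcceptsColoring.of_meetFamily {l : ℕ} {F₁ F₂ : Finset (Finset V)} {c : V → C}
    (h : AcceptsColoring (meetFamily l F₁ F₂) c) :
    AcceptsColoring F₁ c ∧ AcceptsColoring F₂ c := by
  obtain ⟨D, hD, hcD⟩ := h
  obtain ⟨A, hA, B, hB, rfl⟩ := mem_image₂.1 (mem_filter.1 hD).1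
  exact ⟨⟨A, hA, hcD.mono (by simp)⟩, ⟨B, hB, hcD.mono (by simp)⟩⟩

variable [Fintype V] [Fintype C]

open Classical in
/-- A family of sets of size at most `l` is closed if it contains every such set whose addition
would let it accept at most `η` new colourings. -/
def IsClosedFamily (C : Type*) [Fintype C] (l : ℕ) (η : ℝ) (F : Finset (Finset V)) : Prop :=
  (∀ A ∈ F, #A ≤ l) ∧ ∀ A : Finset V, #A ≤ l →
    (#{c : V → C | Set.InjOn c A ∧ ¬ AcceptsColoring F c} : ℝ) ≤ η → A ∈ F

/-- The sets of at most `l` vertices. -/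
def smallSets (V : Type*) [Fintype V] [DecidableEq V] (l : ℕ) : Finset (Finset V) :=
  {A | #A ≤ l}

lemma mem_smallSets {l : ℕ} {A : Finset V} : A ∈ smallSets V l ↔ #A ≤ l := by
  simp [smallSets]

open Classical in
/-- Closing a family adds at most `#(smallSets V l)` sets, each for at most `η` new colourings. -/
lemma exists_closed_superset (l : ℕ) {η : ℝ} (hη : 0 ≤ η) (F₀ : Finset (Finset V))
    (hF₀ : ∀ A ∈ F₀, #A ≤ l) :
    ∃ F, F₀ ⊆ F ∧ IsClosedFamily C l η F ∧
      (#{c : V → C | AcceptsColoring F c ∧ ¬ AcceptsColoring F₀ c} : ℝ) ≤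
        #(smallSets V l) * η := by
  suffices h : ∀ n : ℕ, ∀ F₀ : Finset (Finset V), (∀ A ∈ F₀, #A ≤ l) →
      #(smallSets V l \ F₀) = n → ∃ F, F₀ ⊆ F ∧ IsClosedFamily C l η F ∧
        (#{c : V → C | AcceptsColoring F c ∧ ¬ AcceptsColoring F₀ c} : ℝ) ≤ n * η by
    obtain ⟨F, h1, h2, h3⟩ := h _ F₀ hF₀ rfl
    refine ⟨F, h1, h2, h3.trans ?_⟩
    gcongr
    exact sdiff_subset
  intro n
  induction n with
  | zero =>
    intro F₀ hF₀ hn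
    refine ⟨F₀, Subset.rfl, ⟨hF₀, fun A hA _ => ?_⟩, by simp⟩
    rw [card_eq_zero, sdiff_eq_empty_iff_subset] at hn
    exact hn (mem_smallSets.2 hA)
  | succ n ih =>
    intro F₀ hF₀ hn
    by_cases hcl : IsClosedFamily C l η F₀
    · refine ⟨F₀, Subset.rfl, hcl, ?_⟩
      simp only [and_not_self, filter_false, card_empty, Nat.cast_zero]
      positivity
    · obtain ⟨A, hA, hAη, hAF⟩ : ∃ A : Finset V, #A ≤ l ∧
          (#{c : V → C | Set.InjOn c A ∧ ¬ AcceptsColoring F₀ c} : ℝ) ≤ η ∧ A ∉ F₀ := by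
        by_contra! hcon
        exact hcl ⟨hF₀, hcon⟩
      obtain ⟨F, h1, h2, h3⟩ := ih (insert A F₀)
        (fun B hB => by
          rcases mem_insert.1 hB with rfl | hB
          · exact hA
          · exact hF₀ B hB)
        (by
          rw [sdiff_insert, card_erase_of_mem (mem_sdiff.2 ⟨mem_smallSets.2 hA, hAF⟩), hn]
          rfl)
      refine ⟨F, (subset_insert _ _).trans h1, h2, ?_⟩
      have hsub : ({c : V → C | AcceptsColoring F c ∧ ¬ AcceptsColoring F₀ c} : Finset (V → C)) ⊆
          ({c : V → C | AcceptsColoring F c ∧ ¬ AcceptsColoring (insert A F₀) c} : Finset (V → C)) ∪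
          ({c : V → C | Set.InjOn c A ∧ ¬ AcceptsColoring F₀ c} : Finset (V → C)) := by
        intro c hc
        simp only [mem_filter, mem_univ, true_and, mem_union] at hc ⊢
        by_cases h : AcceptsColoring (insert A F₀) c
        · right
          obtain ⟨B, hB, hcB⟩ := h
          rcases mem_insert.1 hB with rfl | hB
          · exact ⟨hcB, hc.2⟩
          · exact absurd ⟨B, hB, hcB⟩ hc.2
        · exact Or.inl ⟨hc.1, h⟩
      have h4 := (card_le_card hsub).trans (card_union_le _ _)
      have h5 : (#{c : V → C | AcceptsColoring F c ∧ ¬ AcceptsColoring F₀ c} : ℝ) ≤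
          #{c : V → C | AcceptsColoring F c ∧ ¬ AcceptsColoring (insert A F₀) c} +
          #{c : V → C | Set.InjOn c A ∧ ¬ AcceptsColoring F₀ c} := by exact_mod_cast h4
      push_cast
      linarith

/-- The inclusion-minimal members of a family. -/
def minimalMembers (F : Finset (Finset V)) : Finset (Finset V) :=
  {A ∈ F | ∀ B ∈ F, B ⊆ A → B = A}

lemma exists_minimalMembers_subset (F : Finset (Finset V)) {A : Finset V} (hA : A ∈ F) :
    ∃ B ∈ minimalMembers F, B ⊆ A := by
  induction A using Finset.strongInduction with
  | H A ih =>
    by_cases h : ∀ B ∈ F, B ⊆ A → B = A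
    · exact ⟨A, mem_filter.2 ⟨hA, h⟩, Subset.rfl⟩
    · push Not at h
      obtain ⟨B, hB, hBA, hne⟩ := h
      obtain ⟨D, hD, hDB⟩ := ih B (ssubset_of_subset_of_ne hBA hne) hB
      exact ⟨D, hD, hDB.trans hBA⟩

/-- A closed family has few minimal members of each size, for the core of a sunflower of minimal
members would belong to the family. -/
lemma card_minimalMembers_le [Nonempty C] (l s M : ℕ) (hs : 1 ≤ s)
    (hls : l < 2 ^ s) (hM0 : 0 < M) (hM : 4 * l ≤ M) (hC : 2 * l ≤ Fintype.card C)
    {F : Finset (Finset V)}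
    (hF : IsClosedFamily C l (Real.exp (-(M / 2 : ℝ)) * Fintype.card (V → C)) F)
    (j : ℕ) (hj : j ≤ l) :
    #{A ∈ minimalMembers F | #A = j} ≤ (16 * s ^ 2 * M) ^ j := by
  classical
  by_contra! hcon
  obtain ⟨Y, hYj, ⟨B, hB, hYB⟩, hY⟩ := exists_sunflower_core (C := C)
    {A ∈ minimalMembers F | #A = j} j s M hs (hj.trans_lt hls) hM0 (by omega)
    (fun B hB => (mem_filter.1 hB).2) (by omega) hcon
  have hYF : Y ∈ F := by
    refine hF.2 Y (by omega) (le_trans ?_ hY)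
    norm_cast
    refine card_le_card fun c hc => ?_
    rw [mem_filter] at hc ⊢
    refine ⟨mem_univ _, hc.2.1, fun A hA hcA => hc.2.2 ⟨A, ?_, hcA⟩⟩
    exact (mem_filter.1 (mem_filter.1 hA).1).1
  rw [mem_filter] at hB
  have h1 := (mem_filter.1 hB.1).2 Y hYF hYB
  have h2 := hB.2
  rw [h1] at hYj
  omega

lemma card_powersetCard_superset (k : ℕ) (A : Finset V) (hA : #A ≤ k) :
    #{X ∈ powersetCard k (univ : Finset V) | A ⊆ X} =
      (Fintype.card V - #A).choose (k - #A) := by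
  rw [← card_univ, ← card_sdiff_of_subset (subset_univ A), ← card_powersetCard]
  refine card_bij' (fun X _ => X \ A) (fun X _ => X ∪ A) ?_ ?_ ?_ ?_
  · intro X hX
    simp only [mem_filter, mem_powersetCard_univ] at hX
    rw [mem_powersetCard]
    exact ⟨sdiff_subset_sdiff (subset_univ _) Subset.rfl, by
      rw [card_sdiff_of_subset hX.2, hX.1]⟩
  · intro X hX
    rw [mem_powersetCard] at hX
    simp only [mem_filter, mem_powersetCard_univ]
    have hd : Disjoint X A := (disjoint_sdiff_self_left).mono_left hX.1
    exact ⟨by rw [card_union_of_disjoint hd, hX.2]; omega, subset_union_right⟩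
  · intro X hX
    simp only [mem_filter] at hX
    exact sdiff_union_of_subset hX.2
  · intro X hX
    rw [mem_powersetCard] at hX
    have hd : Disjoint X A := (disjoint_sdiff_self_left).mono_left hX.1
    rw [union_sdiff_right, sdiff_eq_self_of_disjoint hd]

/-- The `k`-sets that contain a minimal member of `F` of size more than `l / 2`. Only on these can
an `∧` gate lose a clique. -/
def lossSets (k l : ℕ) (F : Finset (Finset V)) : Finset (Finset V) :=
  {X ∈ powersetCard k univ | ∃ A ∈ minimalMembers F, l < 2 * #A ∧ A ⊆ X}

/-- The bound on the number of `k`-sets lost at one input of an `∧` gate on `n`-vertex graphs, if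
there are at most `r ^ j` minimal sets of size `j`. -/
def lossBound (n k l r : ℕ) : ℕ :=
  ∑ j ∈ (range (l + 1)).filter (fun j => l < 2 * j), r ^ j * (n - j).choose (k - j)

lemma card_lossSets_le (k l r : ℕ) (hlk : l ≤ k) (F : Finset (Finset V))
    (hFl : ∀ A ∈ F, #A ≤ l)
    (hF : ∀ j ≤ l, #{A ∈ minimalMembers F | #A = j} ≤ r ^ j) :
    #(lossSets k l F) ≤ lossBound (Fintype.card V) k l r := by
  have hsub : lossSets k l F ⊆ ((range (l + 1)).filter (fun j => l < 2 * j)).biUnion fun j =>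
      ({A ∈ minimalMembers F | #A = j} : Finset (Finset V)).biUnion fun A =>
        {X ∈ powersetCard k (univ : Finset V) | A ⊆ X} := by
    intro X hX
    rw [lossSets, mem_filter] at hX
    obtain ⟨hXk, A, hA, hlA, hAX⟩ := hX
    simp only [mem_biUnion, mem_filter, mem_range]
    exact ⟨#A, ⟨Nat.lt_succ_of_le (hFl A (mem_filter.1 hA).1), hlA⟩, A, ⟨hA, rfl⟩, hXk, hAX⟩
  refine (card_le_card hsub).trans (card_biUnion_le.trans (sum_le_sum fun j hj => ?_))
  rw [mem_filter, mem_range] at hj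
  refine card_biUnion_le.trans ?_
  calc _ ≤ ∑ A ∈ ({A ∈ minimalMembers F | #A = j} : Finset (Finset V)),
        (Fintype.card V - j).choose (k - j) := by
        refine sum_le_sum fun A hA => ?_
        have hAj := (mem_filter.1 hA).2
        rw [card_powersetCard_superset k A (by omega), hAj]
    _ ≤ _ := by
        rw [sum_const, smul_eq_mul]
        exact Nat.mul_le_mul_right _ (hF j (by omega))

lemma AcceptsSet.meetFamily {k l : ℕ} {F₁ F₂ : Finset (Finset V)} {X : Finset V} (hXk : #X = k)
    (h₁ : AcceptsSet F₁ X) (h₂ : AcceptsSet F₂ X) (hX₁ : X ∉ lossSets k l F₁)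
    (hX₂ : X ∉ lossSets k l F₂) : AcceptsSet (meetFamily l F₁ F₂) X := by
  have hsmall : ∀ F : Finset (Finset V), AcceptsSet F X → X ∉ lossSets k l F →
      ∃ A ∈ F, A ⊆ X ∧ 2 * #A ≤ l := by
    rintro F ⟨A', hA', hA'X⟩ hX
    obtain ⟨A, hA, hAA'⟩ := exists_minimalMembers_subset F hA'
    refine ⟨A, (mem_filter.1 hA).1, hAA'.trans hA'X, ?_⟩
    by_contra! hlt
    exact hX (mem_filter.2 ⟨mem_powersetCard_univ.2 hXk, A, hA, hlt, hAA'.trans hA'X⟩)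
  obtain ⟨A, hA, hAX, hAl⟩ := hsmall F₁ h₁ hX₁
  obtain ⟨B, hB, hBX, hBl⟩ := hsmall F₂ h₂ hX₂
  refine ⟨A ∪ B, mem_filter.2 ⟨mem_image₂_of_mem hA hB, ?_⟩, union_subset hAX hBX⟩
  have := card_union_le A B
  omega

end Approximators

/-! ### Approximating a circuit gate by gate -/

section Circuits

open Finset

open Classical in
/-- The input encoding the graph whose only edges are those of the clique on `X`. -/
noncomputable def cliqueInput {n : ℕ} (X : Finset (Fin n)) : PotentialEdge n → Bool :=
  fun e => decide (∀ v ∈ e.1, v ∈ X)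

open Classical in
/-- The input encoding the complete multipartite graph of the pairs with different colours. -/
noncomputable def coloringInput {n : ℕ} {C : Type*} (c : Fin n → C) : PotentialEdge n → Bool :=
  fun e => decide (¬ (e.1.map c).IsDiag)

lemma cliqueFunction_cliqueInput {n k : ℕ} {X : Finset (Fin n)} (hX : #X = k) :
    cliqueFunction n k (cliqueInput X) = true := by
  simp only [cliqueFunction, decide_eq_true_eq]
  refine ⟨X, ?_, hX⟩
  intro u hu v hv huv
  simp only [graphOfBits, SimpleGraph.fromEdgeSet_adj, cliqueInput, decide_eq_true_eq]
  refine ⟨⟨by simpa using huv, ?_⟩, huv⟩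
  intro w hw
  rcases Sym2.mem_iff.1 hw with rfl | rfl
  · exact hu
  · exact hv

lemma cliqueFunction_coloringInput {n k : ℕ} {C : Type*} [Fintype C] (hk : Fintype.card C < k)
    (c : Fin n → C) : cliqueFunction n k (coloringInput c) = false := by
  rw [← Bool.not_eq_true]
  simp only [cliqueFunction, decide_eq_true_eq, not_exists]
  rintro X ⟨hX, hXk⟩
  obtain ⟨u, hu, v, hv, huv, hc⟩ := exists_ne_map_eq_of_card_lt_of_maps_to
    (s := X) (t := (univ : Finset C)) (f := c) (by rw [card_univ]; omega) (fun _ _ => by simp)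
  have hadj := hX hu hv huv
  simp only [graphOfBits, SimpleGraph.fromEdgeSet_adj, coloringInput, decide_eq_true_eq] at hadj
  obtain ⟨⟨-, h⟩, -⟩ := hadj
  exact h (by simpa using hc)

/-- The closed family `F` approximates the Boolean function `g`: it accepts every `k`-clique that
`g` accepts, apart from the cliques on the sets in `P`, and `g` accepts every colouring that `F`
accepts, apart from the colourings in `N`. -/
structure Approximates {n : ℕ} {C : Type*} [Fintype C] (k l : ℕ) (η : ℝ)
    (P : Finset (Finset (Fin n))) (N : Finset (Fin n → C)) (F : Finset (Finset (Fin n)))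
    (g : (PotentialEdge n → Bool) → Bool) : Prop where
  closed : IsClosedFamily C l η F
  clique : ∀ X, #X = k → X ∉ P → g (cliqueInput X) = true → AcceptsSet F X
  coloring : ∀ c, c ∉ N → AcceptsColoring F c → g (coloringInput c) = true

variable {n : ℕ} {C : Type*} [Fintype C] {k l : ℕ} {η : ℝ}

lemma Approximates.mono {P P' : Finset (Finset (Fin n))} {N N' : Finset (Fin n → C)}
    {F : Finset (Finset (Fin n))} {g : (PotentialEdge n → Bool) → Bool}
    (h : Approximates k l η P N F g) (hP : P ⊆ P') (hN : N ⊆ N') :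
    Approximates k l η P' N' F g :=
  ⟨h.closed, fun X hX hXP => h.clique X hX fun h' => hXP (hP h'),
    fun c hc => h.coloring c fun h' => hc (hN h')⟩

/-- A family that is exact on the relevant inputs becomes an approximator after closing it. -/
lemma exists_approximates_closure (hη : 0 ≤ η) {P : Finset (Finset (Fin n))}
    {N : Finset (Fin n → C)} (F₀ : Finset (Finset (Fin n))) (hF₀ : ∀ A ∈ F₀, #A ≤ l)
    (g : (PotentialEdge n → Bool) → Bool)
    (hpos : ∀ X, #X = k → X ∉ P → g (cliqueInput X) = true → AcceptsSet F₀ X)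
    (hneg : ∀ c, c ∉ N → AcceptsColoring F₀ c → g (coloringInput c) = true) :
    ∃ (F : Finset (Finset (Fin n))) (N' : Finset (Fin n → C)), N ⊆ N' ∧
      (#N' : ℝ) ≤ #N + #(smallSets (Fin n) l) * η ∧ Approximates k l η P N' F g := by
  classical
  obtain ⟨F, h1, h2, h3⟩ := exists_closed_superset (C := C) l hη F₀ hF₀
  refine ⟨F, N ∪ ({c : Fin n → C | AcceptsColoring F c ∧ ¬ AcceptsColoring F₀ c} : Finset _),
    subset_union_left, ?_, h2, fun X hX hXP hg => (hpos X hX hXP hg).mono h1, fun c hc hFc => ?_⟩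
  · refine le_trans ?_ (add_le_add_right h3 _)
    exact_mod_cast card_union_le _ _
  · rw [mem_union, not_or, mem_filter] at hc
    refine hneg c hc.1 ?_
    by_contra hcon
    exact hc.2 ⟨mem_univ _, hFc, hcon⟩

lemma exists_approximates_input (hη : 0 ≤ η) (hl : 2 ≤ l) (e : PotentialEdge n) :
    ∃ (F : Finset (Finset (Fin n))) (N : Finset (Fin n → C)),
      (#N : ℝ) ≤ #(smallSets (Fin n) l) * η ∧ Approximates k l η ∅ N F (fun x => x e) := by
  obtain ⟨e, he⟩ := e
  induction e using Sym2.ind with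
  | _ u v =>
    obtain ⟨F, N, -, hN, h⟩ := exists_approximates_closure (k := k) (l := l) (P := ∅)
      (N := (∅ : Finset (Fin n → C))) hη {{u, v}} (by
        intro A hA
        rw [mem_singleton.1 hA]
        exact card_le_two.trans hl) (fun x => x ⟨s(u, v), he⟩) (by
        intro X _ _ hg
        simp only [cliqueInput, decide_eq_true_eq] at hg
        refine ⟨_, mem_singleton_self _, ?_⟩
        intro w hw
        apply hg
        simpa using hw) (by
        rintro c - ⟨A, hA, hcA⟩
        rw [mem_singleton.1 hA] at hcA
        simp only [coloringInput, decide_eq_true_eq]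
        intro hd
        have huv : u = v := hcA (by simp) (by simp) (by simpa using hd)
        exact he (by simpa using huv))
    exact ⟨F, N, by simpa using hN, h⟩

lemma approximates_true {P : Finset (Finset (Fin n))} {N : Finset (Fin n → C)} :
    Approximates k l η P N (smallSets (Fin n) l) (fun _ => true) :=
  ⟨⟨fun _ hA => mem_smallSets.1 hA, fun _ hA _ => mem_smallSets.2 hA⟩,
    fun X _ _ _ => ⟨∅, mem_smallSets.2 (by simp), empty_subset _⟩, fun _ _ _ => rfl⟩

lemma exists_approximates_false (hη : 0 ≤ η) :
    ∃ (F : Finset (Finset (Fin n))) (N : Finset (Fin n → C)),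
      (#N : ℝ) ≤ #(smallSets (Fin n) l) * η ∧ Approximates k l η ∅ N F (fun _ => false) := by
  obtain ⟨F, N, -, hN, h⟩ := exists_approximates_closure (k := k) (l := l) (P := ∅)
    (N := (∅ : Finset (Fin n → C))) hη ∅ (by simp) (fun _ => false) (by simp) (by
      rintro c - ⟨A, hA, -⟩
      simp at hA)
  exact ⟨F, N, by simpa using hN, h⟩

lemma exists_approximates_or (hη : 0 ≤ η) {P : Finset (Finset (Fin n))}
    {N : Finset (Fin n → C)} {F₁ F₂ : Finset (Finset (Fin n))}
    {g₁ g₂ : (PotentialEdge n → Bool) → Bool} (h₁ : Approximates k l η P N F₁ g₁)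
    (h₂ : Approximates k l η P N F₂ g₂) :
    ∃ (F : Finset (Finset (Fin n))) (N' : Finset (Fin n → C)), N ⊆ N' ∧
      (#N' : ℝ) ≤ #N + #(smallSets (Fin n) l) * η ∧
      Approximates k l η P N' F (fun x => g₁ x || g₂ x) := by
  refine exists_approximates_closure hη (F₁ ∪ F₂) ?_ _ ?_ ?_
  · intro A hA
    rcases mem_union.1 hA with hA | hA
    · exact h₁.closed.1 A hA
    · exact h₂.closed.1 A hA
  · intro X hX hXP hg
    rcases Bool.or_eq_true_iff.1 hg with hg | hg
    · exact (h₁.clique X hX hXP hg).mono subset_union_left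
    · exact (h₂.clique X hX hXP hg).mono subset_union_right
  · rintro c hc ⟨A, hA, hcA⟩
    rw [Bool.or_eq_true_iff]
    rcases mem_union.1 hA with hA | hA
    · exact Or.inl (h₁.coloring c hc ⟨A, hA, hcA⟩)
    · exact Or.inr (h₂.coloring c hc ⟨A, hA, hcA⟩)

lemma exists_approximates_and (hη : 0 ≤ η) {P : Finset (Finset (Fin n))}
    {N : Finset (Fin n → C)} {F₁ F₂ : Finset (Finset (Fin n))}
    {g₁ g₂ : (PotentialEdge n → Bool) → Bool} (h₁ : Approximates k l η P N F₁ g₁)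
    (h₂ : Approximates k l η P N F₂ g₂) :
    ∃ (F : Finset (Finset (Fin n))) (N' : Finset (Fin n → C)), N ⊆ N' ∧
      (#N' : ℝ) ≤ #N + #(smallSets (Fin n) l) * η ∧
      Approximates k l η (P ∪ lossSets k l F₁ ∪ lossSets k l F₂) N' F
        (fun x => g₁ x && g₂ x) := by
  refine exists_approximates_closure hη (meetFamily l F₁ F₂) ?_ _ ?_ ?_
  · exact fun A hA => (mem_filter.1 hA).2
  · intro X hX hXP hg
    simp only [mem_union, not_or] at hXP
    rw [Bool.and_eq_true_iff] at hg
    exact (h₁.clique X hX hXP.1.1 hg.1).meetFamily hX (h₂.clique X hX hXP.1.1 hg.2)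
      hXP.1.2 hXP.2
  · intro c hc hcF
    rw [Bool.and_eq_true_iff]
    exact ⟨h₁.coloring c hc hcF.of_meetFamily.1, h₂.coloring c hc hcF.of_meetFamily.2⟩

/-- One set of exceptional colourings serves all input variables and constants. -/
lemma exists_approximates_free (hη : 0 ≤ η) (hl : 2 ≤ l) (hn : 1 ≤ n) :
    ∃ N : Finset (Fin n → C), (#N : ℝ) ≤ n ^ 2 * (#(smallSets (Fin n) l) * η) ∧
      (∀ e : PotentialEdge n, ∃ F, Approximates k l η ∅ N F (fun x => x e)) ∧
      ∀ b : Bool, ∃ F, Approximates k l η ∅ N F (fun _ => b) := by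
  classical
  choose F N hN hF using fun e : PotentialEdge n =>
    exists_approximates_input (C := C) (k := k) hη hl e
  obtain ⟨F₀, N₀, hN₀, hF₀⟩ := exists_approximates_false (C := C) (n := n) (k := k) (l := l) hη
  set L : ℝ := #(smallSets (Fin n) l) * η with hL
  have hL0 : 0 ≤ L := by positivity
  refine ⟨N₀ ∪ univ.biUnion N, ?_, fun e => ⟨F e, (hF e).mono Subset.rfl ?_⟩, fun b => ?_⟩
  · have h1 : (#(N₀ ∪ univ.biUnion N) : ℝ) ≤ #N₀ + ∑ e, (#(N e) : ℝ) := by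
      exact_mod_cast (card_union_le _ _).trans (Nat.add_le_add_left card_biUnion_le _)
    have h2 : ∑ e, (#(N e) : ℝ) ≤ n.choose 2 * L := by
      refine (sum_le_sum fun e _ => hN e).trans ?_
      rw [sum_const, card_univ, Sym2.card_subtype_not_diag, Fintype.card_fin, nsmul_eq_mul]
    have h3 : n.choose 2 + 1 ≤ n ^ 2 := by
      have : n.choose 2 ≤ n * (n - 1) := by
        rw [Nat.choose_two_right]
        exact Nat.div_le_self _ _
      obtain ⟨m, rfl⟩ : ∃ m, n = m + 1 := ⟨n - 1, by omega⟩
      simp only [Nat.add_sub_cancel] at this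
      nlinarith
    have h4 : ((n.choose 2 + 1 : ℕ) : ℝ) ≤ ((n ^ 2 : ℕ) : ℝ) := Nat.cast_le.2 h3
    push_cast at h4
    nlinarith
  · exact (subset_biUnion_of_mem N (mem_univ e)).trans subset_union_right
  · cases b
    · exact ⟨F₀, hF₀.mono Subset.rfl subset_union_left⟩
    · exact ⟨_, approximates_true⟩

/-- Every wire of a circuit with `m` gates is approximated by a closed family, with exceptional
sets that grow by a bounded amount with each gate. -/
lemma exists_approximates_gates (hη : 0 ≤ η) (hl : 2 ≤ l) (hn : 1 ≤ n) (B : ℕ)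
    (hloss : ∀ F, IsClosedFamily C l η F → #(lossSets (V := Fin n) k l F) ≤ B)
    {m : ℕ} (G : MonotoneGates (PotentialEdge n) m) :
    ∃ (P : Finset (Finset (Fin n))) (N : Finset (Fin n → C)), #P ≤ m * (2 * B) ∧
      (#N : ℝ) ≤ (n ^ 2 + m) * (#(smallSets (Fin n) l) * η) ∧
      ∀ w : MonotoneWire (PotentialEdge n) m,
        ∃ F, Approximates k l η P N F (fun x => w.eval x (G.eval x)) := by
  induction G with
  | nil =>
    obtain ⟨N, hN, hin, hconst⟩ := exists_approximates_free (C := C) (k := k) hη hl hn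
    refine ⟨∅, N, by simp, by simpa using hN, fun w => ?_⟩
    cases w with
    | input e => exact hin e
    | const b => exact hconst b
    | gate j => exact j.elim0
  | @and m G a b ih =>
    obtain ⟨P, N, hP, hN, h⟩ := ih
    obtain ⟨F₁, h₁⟩ := h a
    obtain ⟨F₂, h₂⟩ := h b
    obtain ⟨F, N', hNN', hN', hF⟩ := exists_approximates_and hη h₁ h₂
    have hPP' : P ⊆ P ∪ lossSets k l F₁ ∪ lossSets k l F₂ :=
      subset_union_left.trans subset_union_left
    refine ⟨P ∪ lossSets k l F₁ ∪ lossSets k l F₂, N', ?_, ?_, fun w => ?_⟩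
    · have h3 := card_union_le (P ∪ lossSets k l F₁) (lossSets k l F₂)
      have h4 := card_union_le P (lossSets k l F₁)
      have h5 := hloss F₁ h₁.closed
      have h6 := hloss F₂ h₂.closed
      rw [add_mul]
      omega
    · push_cast
      linarith
    · cases w with
      | input e =>
        obtain ⟨E, hE⟩ := h (.input e)
        exact ⟨E, hE.mono hPP' hNN'⟩
      | const b =>
        obtain ⟨E, hE⟩ := h (.const b)
        exact ⟨E, hE.mono hPP' hNN'⟩
      | gate j =>
        induction j using Fin.lastCases with
        | last =>
          refine ⟨F, ?_⟩
          simpa [MonotoneWire.eval.eq_3, MonotoneGates.eval] using hF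
        | cast j =>
          obtain ⟨E, hE⟩ := h (.gate j)
          refine ⟨E, ?_⟩
          simpa [MonotoneWire.eval.eq_3, MonotoneGates.eval] using hE.mono hPP' hNN'
  | @or m G a b ih =>
    obtain ⟨P, N, hP, hN, h⟩ := ih
    obtain ⟨F₁, h₁⟩ := h a
    obtain ⟨F₂, h₂⟩ := h b
    obtain ⟨F, N', hNN', hN', hF⟩ := exists_approximates_or hη h₁ h₂
    refine ⟨P, N', ?_, ?_, fun w => ?_⟩
    · rw [add_mul]
      omega
    · push_cast
      linarith
    · cases w with
      | input e =>
        obtain ⟨E, hE⟩ := h (.input e)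
        exact ⟨E, hE.mono Subset.rfl hNN'⟩
      | const b =>
        obtain ⟨E, hE⟩ := h (.const b)
        exact ⟨E, hE.mono Subset.rfl hNN'⟩
      | gate j =>
        induction j using Fin.lastCases with
        | last =>
          refine ⟨F, ?_⟩
          simpa [MonotoneWire.eval.eq_3, MonotoneGates.eval] using hF
        | cast j =>
          obtain ⟨E, hE⟩ := h (.gate j)
          refine ⟨E, ?_⟩
          simpa [MonotoneWire.eval.eq_3, MonotoneGates.eval] using hE.mono Subset.rfl hNN'

open Classical in
/-- At least a fraction `(card C) ^ (-l)` of all colourings is injective on a given set of size at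
most `l`. -/
lemma card_le_card_injOn_mul (A : Finset (Fin n)) (hA : #A ≤ l) (hC : l ≤ Fintype.card C)
    (hC0 : 1 ≤ Fintype.card C) :
    Fintype.card (Fin n → C) ≤ Fintype.card C ^ l * #{c : Fin n → C | Set.InjOn c A} := by
  have : Nonempty C := Fintype.card_pos_iff.1 hC0
  obtain ⟨σ⟩ : Nonempty (A ↪ C) := Function.Embedding.nonempty_of_card_le (by
    rw [Fintype.card_coe]; omega)
  let g : Fin n → C := fun v => if h : v ∈ A then σ ⟨v, h⟩ else this.some
  have hg : Set.InjOn g A := by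
    intro u hu v hv huv
    simp only [g, dif_pos (mem_coe.1 hu), dif_pos (mem_coe.1 hv)] at huv
    exact congrArg Subtype.val (σ.injective huv)
  rw [← card_univ]
  refine card_le_mul_card_image_of_maps_to (f := fun c => A.piecewise g c) ?_ _ ?_
  · intro c _
    rw [mem_filter]
    refine ⟨mem_univ _, hg.congr fun v hv => ?_⟩
    exact (piecewise_eq_of_mem _ _ _ (mem_coe.1 hv)).symm
  · intro f' _
    calc _ ≤ #{c : Fin n → C | ∀ v ∉ A, c v = f' v} := by
          refine card_le_card fun c hc => ?_
          rw [mem_filter] at hc ⊢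
          refine ⟨mem_univ _, fun v hv => ?_⟩
          rw [← hc.2, piecewise_eq_of_notMem _ _ _ hv]
      _ ≤ Fintype.card C ^ #A := by convert card_agree_off_le A f'
      _ ≤ _ := Nat.pow_le_pow_right hC0 hA

/-- A circuit for the clique function either loses all cliques, so that it has many `∧` gates, or
its approximator is nonempty and therefore wrongly accepts a noticeable fraction of the
colourings. -/
theorem circuit_size_dichotomy (n k l s M : ℕ) (hn : 1 ≤ n) (hl : 2 ≤ l) (hlk : 2 * l < k)
    (hs : 1 ≤ s) (hls : l < 2 ^ s) (hM0 : 0 < M) (hM : 4 * l ≤ M)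
    (G : MonotoneCircuit (PotentialEdge n)) (hG : G.Computes (cliqueFunction n k)) :
    n.choose k ≤ G.size * (2 * lossBound n k l (16 * s ^ 2 * M)) ∨
    1 ≤ ((k - 1 : ℕ) : ℝ) ^ l * ((n ^ 2 + G.size) *
      (#(smallSets (Fin n) l) * Real.exp (-(M / 2 : ℝ)))) := by
  classical
  obtain ⟨C, _, hC⟩ : ∃ (C : Type) (_ : Fintype C), Fintype.card C = k - 1 :=
    ⟨Fin (k - 1), inferInstance, Fintype.card_fin _⟩
  have : Nonempty C := Fintype.card_pos_iff.1 (by omega)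
  set T : ℝ := ((Fintype.card (Fin n → C) : ℕ) : ℝ) with hT
  have hT0 : 0 < T := by
    rw [hT]
    exact_mod_cast Fintype.card_pos
  set η : ℝ := Real.exp (-(M / 2 : ℝ)) * T with hη
  have hη0 : 0 ≤ η := by positivity
  obtain ⟨P, N, hP, hN, hw⟩ := exists_approximates_gates (C := C) (k := k) hη0 hl hn
    (lossBound n k l (16 * s ^ 2 * M)) (fun F hF => by
      have h := card_lossSets_le k l (16 * s ^ 2 * M) (by omega) F hF.1 fun j hj =>
        card_minimalMembers_le l s M hs hls hM0 hM (by omega) hF j hj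
      rwa [Fintype.card_fin] at h) G.gates
  obtain ⟨F, hF⟩ := hw G.output
  have hGF : ∀ x, G.output.eval x (G.gates.eval x) = cliqueFunction n k x := hG
  rcases F.eq_empty_or_nonempty with rfl | ⟨A, hA⟩
  · left
    refine le_trans ?_ hP
    have hsub : powersetCard k (univ : Finset (Fin n)) ⊆ P := by
      intro X hX
      rw [mem_powersetCard_univ] at hX
      by_contra hXP
      obtain ⟨A, hA, -⟩ := hF.clique X hX hXP (by
        rw [hGF]; exact cliqueFunction_cliqueInput hX)
      simp at hA
    have := card_le_card hsub
    rwa [card_powersetCard, card_univ, Fintype.card_fin] at this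
  · right
    have hsub : ({c : Fin n → C | Set.InjOn c A} : Finset (Fin n → C)) ⊆ N := by
      intro c hc
      by_contra hcN
      have h := hF.coloring c hcN ⟨A, hA, (mem_filter.1 hc).2⟩
      rw [hGF, cliqueFunction_coloringInput (by omega)] at h
      exact Bool.false_ne_true h
    have h1 := card_le_card_injOn_mul (C := C) A (hF.closed.1 A hA) (by omega) (by omega)
    have h2 : T ≤ ((k - 1 : ℕ) : ℝ) ^ l * #N := by
      rw [hT, ← hC]
      refine le_trans (Nat.cast_le.2 h1) ?_
      push_cast
      gcongr
    have h3 : T ≤ T * (((k - 1 : ℕ) : ℝ) ^ l * ((n ^ 2 + G.size) *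
      (#(smallSets (Fin n) l) * Real.exp (-(M / 2 : ℝ))))) := by
      calc T ≤ ((k - 1 : ℕ) : ℝ) ^ l * #N := h2
        _ ≤ ((k - 1 : ℕ) : ℝ) ^ l * ((n ^ 2 + G.size) * (#(smallSets (Fin n) l) * η)) := by
            gcongr
        _ = _ := by rw [hη]; ring
    exact le_of_mul_le_mul_left (by linarith) hT0

end Circuits

/-! ### A bound from the number of relevant variables -/

section Variables

open Finset

/-- A fan-in-two circuit with `m` gates reads at most `2 m` inputs through its gates. -/
lemma exists_dependsOn_gates {ι : Type} [DecidableEq ι] {m : ℕ} (G : MonotoneGates ι m) :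
    ∃ S : Finset ι, #S ≤ 2 * m ∧ ∀ x y : ι → Bool, (∀ i ∈ S, x i = y i) →
      G.eval x = G.eval y := by
  have hwire : ∀ {m : ℕ} (a : MonotoneWire ι m), ∃ S : Finset ι, #S ≤ 1 ∧
      ∀ (x y : ι → Bool) (g : Fin m → Bool), (∀ i ∈ S, x i = y i) → a.eval x g = a.eval y g := by
    intro m a
    cases a with
    | input i => exact ⟨{i}, by simp, fun x y g h => h i (mem_singleton_self i)⟩
    | const b => exact ⟨∅, by simp, fun x y g _ => rfl⟩
    | gate j => exact ⟨∅, by simp, fun x y g _ => rfl⟩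
  induction G with
  | nil => exact ⟨∅, by simp, fun x y _ => rfl⟩
  | and G a b ih =>
    obtain ⟨S, hS, h⟩ := ih
    obtain ⟨A, hA, ha⟩ := hwire a
    obtain ⟨B, hB, hb⟩ := hwire b
    refine ⟨S ∪ (A ∪ B), ?_, fun x y hxy => ?_⟩
    · have h1 := card_union_le S (A ∪ B)
      have h2 := card_union_le A B
      omega
    · simp only [mem_union] at hxy
      simp only [MonotoneGates.eval]
      rw [h x y fun i hi => hxy i (Or.inl hi), ha x y _ fun i hi => hxy i (Or.inr (Or.inl hi)),
        hb x y _ fun i hi => hxy i (Or.inr (Or.inr hi))]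
  | or G a b ih =>
    obtain ⟨S, hS, h⟩ := ih
    obtain ⟨A, hA, ha⟩ := hwire a
    obtain ⟨B, hB, hb⟩ := hwire b
    refine ⟨S ∪ (A ∪ B), ?_, fun x y hxy => ?_⟩
    · have h1 := card_union_le S (A ∪ B)
      have h2 := card_union_le A B
      omega
    · simp only [mem_union] at hxy
      simp only [MonotoneGates.eval]
      rw [h x y fun i hi => hxy i (Or.inl hi), ha x y _ fun i hi => hxy i (Or.inr (Or.inl hi)),
        hb x y _ fun i hi => hxy i (Or.inr (Or.inr hi))]

lemma exists_dependsOn_circuit {ι : Type} [DecidableEq ι] (G : MonotoneCircuit ι) :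
    ∃ S : Finset ι, #S ≤ 2 * G.size + 1 ∧ ∀ x y : ι → Bool, (∀ i ∈ S, x i = y i) →
      G.eval x = G.eval y := by
  obtain ⟨m, G, w⟩ := G
  obtain ⟨S, hS, h⟩ := exists_dependsOn_gates G
  cases w with
  | input i =>
    refine ⟨insert i S, (card_insert_le _ _).trans (by simpa using hS), fun x y hxy => ?_⟩
    exact hxy i (mem_insert_self _ _)
  | const b => exact ⟨∅, by simp, fun x y _ => rfl⟩
  | gate j =>
    refine ⟨S, by simpa using hS.trans (Nat.le_succ _), fun x y hxy => ?_⟩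
    simp only [MonotoneCircuit.eval]
    rw [h x y hxy]
    rfl

/-- A clique on `k ≥ 2` vertices is no longer a graph with a `k`-clique after removing an edge. -/
lemma cliqueFunction_update_cliqueInput {n k : ℕ} (hk : 2 ≤ k) {X : Finset (Fin n)} (hX : #X = k)
    (e : PotentialEdge n) (he : ∀ v ∈ e.1, v ∈ X) :
    cliqueFunction n k (Function.update (cliqueInput X) e false) = false := by
  classical
  rw [← Bool.not_eq_true]
  simp only [cliqueFunction, decide_eq_true_eq, not_exists]
  rintro s ⟨hs, hsk⟩
  have hadj : ∀ u v, (graphOfBits (Function.update (cliqueInput X) e false)).Adj u v →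
      u ∈ X ∧ s(u, v) ≠ e.1 := by
    intro u v h
    simp only [graphOfBits, SimpleGraph.fromEdgeSet_adj] at h
    obtain ⟨⟨hd, h⟩, -⟩ := h
    by_cases hue : (⟨s(u, v), hd⟩ : PotentialEdge n) = e
    · rw [hue] at h
      simp at h
    · rw [Function.update_of_ne hue] at h
      simp only [cliqueInput, decide_eq_true_eq] at h
      exact ⟨h u (by simp), fun h' => hue (Subtype.ext h')⟩
  have hsX : s ⊆ X := by
    intro u hu
    obtain ⟨v, hv, hvu⟩ := exists_mem_ne (by omega : 1 < #s) u
    exact (hadj u v (hs hu hv hvu.symm)).1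
  have heq : s = X := eq_of_subset_of_card_le hsX (by omega)
  subst heq
  obtain ⟨e, hed⟩ := e
  induction e using Sym2.ind with
  | _ u v =>
    have huv : u ≠ v := by simpa using hed
    exact (hadj u v (hs (he u (by simp)) (he v (by simp)) huv)).2 rfl

/-- The clique function depends on each of its `n.choose 2` variables. -/
lemma choose_two_le_of_computes {n k : ℕ} (hk : 2 ≤ k) (hkn : k ≤ n)
    (G : MonotoneCircuit (PotentialEdge n)) (hG : G.Computes (cliqueFunction n k)) :
    n.choose 2 ≤ 2 * G.size + 1 := by
  classical
  obtain ⟨S, hS, h⟩ := exists_dependsOn_circuit G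
  refine le_trans ?_ hS
  have huniv : (univ : Finset (PotentialEdge n)) ⊆ S := by
    intro e _
    by_contra heS
    obtain ⟨X, heX, -, hX⟩ := exists_subsuperset_card_eq (n := k)
      (subset_univ (e.1.toFinset)) (by
        rw [Sym2.card_toFinset_of_not_isDiag _ e.2]; exact hk) (by simpa using hkn)
    have he : ∀ v ∈ e.1, v ∈ X := fun v hv => heX (Sym2.mem_toFinset.2 hv)
    have h1 := h (cliqueInput X) (Function.update (cliqueInput X) e false) fun i hi => by
      rw [Function.update_of_ne]
      rintro rfl
      exact heS hi
    rw [hG, hG, cliqueFunction_cliqueInput hX, cliqueFunction_update_cliqueInput hk hX e he] at h1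
    exact Bool.false_ne_true h1.symm
  have := card_le_card huniv
  rwa [card_univ, Sym2.card_subtype_not_diag, Fintype.card_fin] at this

end Variables

/-! ### Estimates -/

section Estimates

open Finset

/-- A random `k`-set contains a given `j`-set with probability at most `(k / n) ^ j`. -/
lemma choose_sub_mul_pow_le {n k : ℕ} (hkn : k ≤ n) (j : ℕ) (hj : j ≤ k) :
    (n - j).choose (k - j) * n ^ j ≤ n.choose k * k ^ j := by
  induction j with
  | zero => simp
  | succ j ih =>
    have ih := ih (by omega)
    obtain ⟨a, ha⟩ : ∃ a, n - j = a + 1 := ⟨n - j - 1, by omega⟩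
    obtain ⟨b, hb⟩ : ∃ b, k - j = b + 1 := ⟨k - j - 1, by omega⟩
    have ha' : n - (j + 1) = a := by omega
    have hb' : k - (j + 1) = b := by omega
    rw [ha, hb] at ih
    rw [ha', hb']
    have h1 : (a + 1) * a.choose b = (a + 1).choose (b + 1) * (b + 1) :=
      Nat.add_one_mul_choose_eq a b
    have h2 : (b + 1) * n ≤ k * (a + 1) := by
      obtain ⟨rfl, rfl⟩ : n = a + 1 + j ∧ k = b + 1 + j := by omega
      nlinarith
    have h3 : a.choose b * n ≤ (a + 1).choose (b + 1) * k := by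
      refine Nat.le_of_mul_le_mul_left ?_ (by omega : 0 < a + 1)
      calc (a + 1) * (a.choose b * n) = (a + 1).choose (b + 1) * ((b + 1) * n) := by
            rw [← mul_assoc, h1, mul_assoc]
        _ ≤ (a + 1).choose (b + 1) * (k * (a + 1)) := Nat.mul_le_mul_left _ h2
        _ = _ := by ring
    calc a.choose b * n ^ (j + 1) = a.choose b * n * n ^ j := by ring
      _ ≤ (a + 1).choose (b + 1) * k * n ^ j := Nat.mul_le_mul_right _ h3
      _ = (a + 1).choose (b + 1) * n ^ j * k := by ring
      _ ≤ n.choose k * k ^ j * k := Nat.mul_le_mul_right _ ih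
      _ = _ := by ring

lemma card_smallSets_le {n l : ℕ} (hl : 1 ≤ l) (hln : l < n) :
    #(smallSets (Fin n) l) ≤ n ^ (2 * l) := by
  have hsub : smallSets (Fin n) l ⊆ (range (l + 1)).biUnion fun j => powersetCard j univ := by
    intro A hA
    rw [mem_smallSets] at hA
    simp only [mem_biUnion, mem_range, mem_powersetCard_univ]
    exact ⟨#A, by omega, rfl⟩
  calc _ ≤ ∑ j ∈ range (l + 1), #(powersetCard j (univ : Finset (Fin n))) :=
        (card_le_card hsub).trans card_biUnion_le
    _ ≤ ∑ j ∈ range (l + 1), n ^ l := by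
        refine sum_le_sum fun j hj => ?_
        rw [card_powersetCard, card_univ, Fintype.card_fin]
        rw [mem_range] at hj
        exact (Nat.choose_le_pow n j).trans (Nat.pow_le_pow_right (by omega) (by omega))
    _ = (l + 1) * n ^ l := by rw [sum_const, card_range, smul_eq_mul]
    _ ≤ n ^ l * n ^ l := by
        gcongr
        calc l + 1 ≤ n ^ 1 := by rw [pow_one]; exact hln
          _ ≤ n ^ l := Nat.pow_le_pow_right (by omega) hl
    _ = _ := by rw [two_mul, pow_add]

lemma two_mul_succ_le_four_pow {l : ℕ} (hl : 1 ≤ l) : 2 * (l + 1) ≤ 4 ^ l := by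
  induction l, hl using Nat.le_induction with
  | base => norm_num
  | succ l hl ih =>
    rw [pow_succ]
    omega

/-- If `r k / n` is at most `n ^ (-2 δ) / 16`, a circuit that loses all cliques has size at least
`n ^ (δ l)`. -/
lemma le_size_of_choose_le {n k l r m : ℕ} (hn : 1 ≤ n) (hl : 1 ≤ l) (hlk : l ≤ k) (hkn : k ≤ n)
    {δ : ℝ} (hδ : 0 ≤ δ) (hr : (r * k / n : ℝ) ≤ (n : ℝ) ^ (-(2 * δ)) / 16)
    (h : n.choose k ≤ m * (2 * lossBound n k l r)) : (n : ℝ) ^ (δ * l) ≤ m := by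
  have hn0 : (0 : ℝ) < n := by exact_mod_cast hn
  have hn1 : (1 : ℝ) ≤ n := by exact_mod_cast hn
  have hch : (0 : ℝ) < n.choose k := by exact_mod_cast Nat.choose_pos hkn
  have hterm : ∀ j ∈ (range (l + 1)).filter (fun j => l < 2 * j),
      ((r ^ j * (n - j).choose (k - j) : ℕ) : ℝ) ≤
        n.choose k * ((n : ℝ) ^ (-(δ * l)) / 4 ^ l) := by
    intro j hj
    rw [mem_filter, mem_range] at hj
    have h1 : ((n - j).choose (k - j) : ℝ) * (n : ℝ) ^ j ≤ n.choose k * (k : ℝ) ^ j := by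
      exact_mod_cast choose_sub_mul_pow_le hkn j (by omega)
    have h2 : ((n - j).choose (k - j) : ℝ) ≤ n.choose k * (k / n : ℝ) ^ j := by
      rw [div_pow, ← mul_div_assoc, le_div_iff₀ (by positivity)]
      exact h1
    have h3 : ((n : ℝ) ^ (-(2 * δ)) / 16) ^ j ≤ (n : ℝ) ^ (-(δ * l)) / 4 ^ l := by
      rw [div_pow]
      have hlj : (l : ℝ) ≤ 2 * j := by exact_mod_cast hj.2.le
      refine div_le_div₀ (by positivity) ?_ (by positivity) ?_
      · rw [← Real.rpow_natCast, ← Real.rpow_mul hn0.le]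
        refine Real.rpow_le_rpow_of_exponent_le hn1 ?_
        nlinarith
      · calc (4 : ℝ) ^ l ≤ 4 ^ (2 * j) := pow_le_pow_right₀ (by norm_num) hj.2.le
          _ = 16 ^ j := by rw [pow_mul]; norm_num
    push_cast
    calc (r : ℝ) ^ j * ((n - j).choose (k - j) : ℝ)
        ≤ (r : ℝ) ^ j * (n.choose k * (k / n : ℝ) ^ j) := by
          gcongr
      _ = n.choose k * (r * k / n : ℝ) ^ j := by
          rw [mul_div_assoc, mul_pow]; ring
      _ ≤ n.choose k * ((n : ℝ) ^ (-(2 * δ)) / 16) ^ j := by gcongr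
      _ ≤ _ := by gcongr
  -- the factor `4 ^ l` absorbs the number of sizes `j` and the two inputs of a gate
  have hloss : (lossBound n k l r : ℝ) ≤
      (l + 1) * (n.choose k * ((n : ℝ) ^ (-(δ * l)) / 4 ^ l)) := by
    rw [lossBound, Nat.cast_sum]
    refine (sum_le_sum hterm).trans ?_
    rw [sum_const, nsmul_eq_mul]
    gcongr
    have : #((range (l + 1)).filter (fun j => l < 2 * j)) ≤ l + 1 :=
      (card_filter_le _ _).trans (card_range _).le
    exact_mod_cast this
  have h4 : (2 : ℝ) * (l + 1) ≤ 4 ^ l := by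
    exact_mod_cast two_mul_succ_le_four_pow hl
  have h5 : (n.choose k : ℝ) ≤ m * (2 * lossBound n k l r) := by exact_mod_cast h
  have h6 : (n.choose k : ℝ) ≤ n.choose k * (m * (n : ℝ) ^ (-(δ * l))) := by
    calc (n.choose k : ℝ) ≤ m * (2 * lossBound n k l r) := h5
      _ ≤ m * (2 * ((l + 1) * (n.choose k * ((n : ℝ) ^ (-(δ * l)) / 4 ^ l)))) := by gcongr
      _ = n.choose k * (m * (n : ℝ) ^ (-(δ * l))) * (2 * (l + 1) / 4 ^ l) := by ring
      _ ≤ n.choose k * (m * (n : ℝ) ^ (-(δ * l))) * 1 := by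
          gcongr
          rw [div_le_one (by positivity)]
          exact h4
      _ = _ := mul_one _
  have h7 : 1 ≤ m * (n : ℝ) ^ (-(δ * l)) := by
    by_contra! hlt
    nlinarith
  rw [Real.rpow_neg hn0.le, ← div_eq_mul_inv, one_le_div (by positivity)] at h7
  exact h7

/-- A circuit that wrongly accepts a noticeable fraction of the colourings has size at least
`n ^ l` when there are `M ≥ 14 l log n` blocks. -/
lemma pow_le_size_of_one_le {n k l M m : ℕ} (hl : 2 ≤ l) (hln : l < n) (hkn : k ≤ n)
    (hM : 14 * l * Real.log n ≤ M)
    (h : 1 ≤ ((k - 1 : ℕ) : ℝ) ^ l * (((n : ℝ) ^ 2 + m) *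
      (#(smallSets (Fin n) l) * Real.exp (-(M / 2 : ℝ))))) : (n : ℝ) ^ l ≤ m := by
  have hn2 : (2 : ℝ) ≤ n := by exact_mod_cast (by omega : 2 ≤ n)
  have hn1 : (1 : ℝ) ≤ n := by linarith
  have hn0 : (0 : ℝ) < n := by linarith
  have h1 : ((k - 1 : ℕ) : ℝ) ≤ n := by exact_mod_cast (by omega : k - 1 ≤ n)
  have h2 : (#(smallSets (Fin n) l) : ℝ) ≤ (n : ℝ) ^ (2 * l) := by
    exact_mod_cast card_smallSets_le (by omega) hln
  have h3 : Real.exp (-(M / 2 : ℝ)) ≤ ((n : ℝ) ^ (7 * l))⁻¹ := by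
    have h4 : (n : ℝ) ^ (7 * l) = Real.exp (7 * l * Real.log n) := by
      rw [← Real.rpow_natCast, Real.rpow_def_of_pos hn0]
      push_cast
      ring_nf
    rw [h4, ← Real.exp_neg]
    exact Real.exp_le_exp.2 (by linarith)
  have h5 : 1 ≤ (n : ℝ) ^ l *
      (((n : ℝ) ^ 2 + m) * ((n : ℝ) ^ (2 * l) * ((n : ℝ) ^ (7 * l))⁻¹)) := by
    refine h.trans ?_
    gcongr
  have h6 : (n : ℝ) ^ (4 * l) ≤ (n : ℝ) ^ 2 + m := by
    have h7 : (n : ℝ) ^ l * (((n : ℝ) ^ 2 + m) * ((n : ℝ) ^ (2 * l) * ((n : ℝ) ^ (7 * l))⁻¹)) =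
        ((n : ℝ) ^ 2 + m) / (n : ℝ) ^ (4 * l) := by
      have : (n : ℝ) ^ (7 * l) = (n : ℝ) ^ l * (n : ℝ) ^ (2 * l) * (n : ℝ) ^ (4 * l) := by
        rw [← pow_add, ← pow_add]; congr 1; ring
      rw [this]
      field_simp
    rw [h7, one_le_div (by positivity)] at h5
    exact h5
  have h8 : (n : ℝ) ^ 2 ≤ (n : ℝ) ^ l := pow_le_pow_right₀ hn1 hl
  have h9 : (n : ℝ) ^ l * (n : ℝ) ^ l ≤ (n : ℝ) ^ (4 * l) := by
    rw [← pow_add]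
    exact pow_le_pow_right₀ hn1 (by omega)
  have h10 : (4 : ℝ) ≤ (n : ℝ) ^ 2 := by nlinarith
  nlinarith

end Estimates

/-! ### Choice of parameters -/

section Asymptotics

/-- The parameters of the approximation: with `l = k / 4`, about `log l` rounds and about
`14 l log n` blocks, the sunflower bound `16 s² M` is small enough compared with `n / k`. -/
lemma exists_rounds_blocks {n k : ℕ} (hk : 8 ≤ k) (hlog : 8640 ≤ Real.log n) {δ : ℝ}
    (hkδ : (k : ℝ) ≤ (n : ℝ) ^ ((1 : ℝ) / 2 - δ) / (Real.log n) ^ 2) (hkn : k ≤ n) :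
    ∃ s M : ℕ, 1 ≤ s ∧ k / 4 < 2 ^ s ∧ 0 < M ∧ 4 * (k / 4) ≤ M ∧
      14 * ((k / 4 : ℕ) : ℝ) * Real.log n ≤ M ∧
      (((16 * s ^ 2 * M : ℕ) : ℝ) * k / n : ℝ) ≤ (n : ℝ) ^ (-(2 * δ)) / 16 := by
  set L := Real.log n with hL
  have hL1 : 1 ≤ L := by linarith
  have hL0 : 0 < L := by linarith
  have hn0 : (0 : ℝ) < n := by exact_mod_cast (by omega : 0 < n)
  set l := k / 4 with hl
  have hl2 : 2 ≤ l := by omega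
  have hl2' : (2 : ℝ) ≤ l := by exact_mod_cast hl2
  have hlk : (l : ℝ) ≤ k / 4 := by
    rw [le_div_iff₀ (by norm_num)]
    exact_mod_cast (by omega : l * 4 ≤ k)
  set s := Nat.log 2 l + 1 with hs
  set M := ⌈14 * (l : ℝ) * L⌉₊ with hM
  have hMge : 14 * (l : ℝ) * L ≤ M := Nat.le_ceil _
  have hMle : (M : ℝ) ≤ 15 * l * L := by
    have := (Nat.ceil_lt_add_one (by positivity : 0 ≤ 14 * (l : ℝ) * L)).le
    nlinarith
  have hsle : (s : ℝ) ≤ 3 * L := by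
    have h1 : 2 ^ Nat.log 2 l ≤ n := (Nat.pow_log_le_self 2 (by omega)).trans (by omega)
    have h2 : (2 : ℝ) ^ Nat.log 2 l ≤ n := by exact_mod_cast h1
    have h3 := Real.log_le_log (by positivity) h2
    rw [Real.log_pow, ← hL] at h3
    have h4 := Real.log_two_gt_d9
    have h5 : (0 : ℝ) ≤ Nat.log 2 l := by positivity
    rw [hs]
    push_cast
    nlinarith
  refine ⟨s, M, by omega, Nat.lt_pow_succ_log_self (by norm_num) l, ?_, ?_, hMge, ?_⟩
  · have : (0 : ℝ) < M := lt_of_lt_of_le (by positivity) hMge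
    exact_mod_cast this
  · have : ((4 * l : ℕ) : ℝ) ≤ M := by
      push_cast
      nlinarith
    exact_mod_cast this
  · have hr : ((16 * s ^ 2 * M : ℕ) : ℝ) ≤ 540 * k * L ^ 3 := by
      push_cast
      calc 16 * (s : ℝ) ^ 2 * M ≤ 16 * (3 * L) ^ 2 * (15 * (k / 4) * L) := by
            gcongr
            exact hMle.trans (by gcongr)
        _ = _ := by ring
    have hk2 : (k : ℝ) ^ 2 ≤ (n : ℝ) * (n : ℝ) ^ (-(2 * δ)) / L ^ 4 := by
      calc (k : ℝ) ^ 2 ≤ ((n : ℝ) ^ ((1 : ℝ) / 2 - δ) / L ^ 2) ^ 2 := by gcongr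
        _ = (n : ℝ) * (n : ℝ) ^ (-(2 * δ)) / L ^ 4 := by
          have h1 : ((n : ℝ) ^ ((1 : ℝ) / 2 - δ)) ^ 2 = (n : ℝ) ^ (1 + -(2 * δ)) := by
            rw [← Real.rpow_natCast, ← Real.rpow_mul hn0.le]
            congr 1
            push_cast
            ring
          rw [div_pow, h1, Real.rpow_add hn0, Real.rpow_one, ← pow_mul]
    calc (((16 * s ^ 2 * M : ℕ) : ℝ) * k / n : ℝ) ≤ 540 * k * L ^ 3 * k / n := by gcongr
      _ = 540 * L ^ 3 * (k : ℝ) ^ 2 / n := by ring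
      _ ≤ 540 * L ^ 3 * ((n : ℝ) * (n : ℝ) ^ (-(2 * δ)) / L ^ 4) / n := by gcongr
      _ = (n : ℝ) ^ (-(2 * δ)) * (540 / L) := by field_simp
      _ ≤ (n : ℝ) ^ (-(2 * δ)) * (1 / 16) := by
          refine mul_le_mul_of_nonneg_left ?_ (by positivity)
          rw [div_le_div_iff₀ hL0 (by norm_num)]
          linarith
      _ = _ := by ring

theorem rpow_le_size_of_computes {n k : ℕ} (hlog : 8640 ≤ Real.log n) {δ : ℝ} (hδ : 0 < δ)
    (hk : 2 ≤ k) (hkδ : (k : ℝ) ≤ (n : ℝ) ^ ((1 : ℝ) / 2 - δ) / (Real.log n) ^ 2)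
    (G : MonotoneCircuit (PotentialEdge n)) (hG : G.Computes (cliqueFunction n k)) :
    (n : ℝ) ^ (1 / 16 * δ ^ 2 * (k : ℝ)) ≤ G.size := by
  have hn8640 : (8640 : ℝ) ≤ n := by
    have hne : (n : ℝ) ≠ 0 := fun h => by
      rw [h, Real.log_zero] at hlog
      norm_num at hlog
    have hpos : (0 : ℝ) < n := lt_of_le_of_ne (Nat.cast_nonneg n) hne.symm
    have := Real.log_le_sub_one_of_pos hpos
    linarith
  have hn : 8640 ≤ n := by exact_mod_cast hn8640
  have hn1 : (1 : ℝ) ≤ n := by linarith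
  have hk2 : (2 : ℝ) ≤ k := by exact_mod_cast hk
  have hkpow : (k : ℝ) ≤ (n : ℝ) ^ ((1 : ℝ) / 2 - δ) :=
    hkδ.trans (div_le_self (by positivity) (by nlinarith))
  have hδ2 : δ < 1 / 2 := by
    by_contra! hge
    have := Real.rpow_le_one_of_one_le_of_nonpos hn1 (by linarith : (1 : ℝ) / 2 - δ ≤ 0)
    linarith
  have hkn : k ≤ n := by
    have : (n : ℝ) ^ ((1 : ℝ) / 2 - δ) ≤ (n : ℝ) ^ (1 : ℝ) :=
      Real.rpow_le_rpow_of_exponent_le hn1 (by linarith)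
    rw [Real.rpow_one] at this
    exact_mod_cast hkpow.trans this
  -- for `k < 8` the exponent is below one; otherwise `k / 4 ≥ 2`, so that edges are small sets
  rcases Nat.lt_or_ge k 8 with hk8 | hk8
  · have h1 := choose_two_le_of_computes hk hkn G hG
    have h2 : n ≤ G.size := by
      have h3 : n * (n - 1) / 2 * 2 = n * (n - 1) :=
        Nat.div_mul_cancel (even_iff_two_dvd.1 (Nat.even_mul_pred_self n))
      have h4 : n * 8 ≤ n * (n - 1) := Nat.mul_le_mul_left _ (by omega)
      rw [Nat.choose_two_right] at h1
      omega
    have hk8' : (k : ℝ) ≤ 8 := by exact_mod_cast hk8.le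
    calc (n : ℝ) ^ (1 / 16 * δ ^ 2 * (k : ℝ)) ≤ (n : ℝ) ^ (1 : ℝ) := by
          refine Real.rpow_le_rpow_of_exponent_le hn1 ?_
          have : δ ^ 2 ≤ 1 / 4 := by nlinarith
          nlinarith
      _ = n := Real.rpow_one _
      _ ≤ _ := by exact_mod_cast h2
  · obtain ⟨s, M, hs, hls, hM0, hM, hMlog, hr⟩ := exists_rounds_blocks hk8 hlog hkδ hkn
    have hl8 : (k : ℝ) / 8 ≤ ((k / 4 : ℕ) : ℝ) := by
      rw [div_le_iff₀ (by norm_num)]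
      exact_mod_cast (by omega : k ≤ k / 4 * 8)
    have hexp : (n : ℝ) ^ (1 / 16 * δ ^ 2 * (k : ℝ)) ≤ (n : ℝ) ^ (δ * ((k / 4 : ℕ) : ℝ)) := by
      refine Real.rpow_le_rpow_of_exponent_le hn1 ?_
      have h1 : δ * ((k : ℝ) / 8) ≤ δ * ((k / 4 : ℕ) : ℝ) := by gcongr
      have h2 : δ ^ 2 * (k : ℝ) ≤ δ * k := by
        gcongr
        nlinarith
      have h3 : 0 ≤ δ * k := by positivity
      linarith
    refine hexp.trans ?_
    rcases circuit_size_dichotomy n k (k / 4) s M (by omega) (by omega) (by omega) hs hls hM0 hM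
      G hG with h | h
    · exact le_size_of_choose_le (by omega) (by omega) (by omega) hkn hδ.le hr h
    · refine le_trans ?_ (pow_le_size_of_one_le (by omega) (by omega) hkn hMlog h)
      rw [← Real.rpow_natCast]
      refine Real.rpow_le_rpow_of_exponent_le hn1 ?_
      have : (0 : ℝ) ≤ ((k / 4 : ℕ) : ℝ) := by positivity
      nlinarith

lemma exists_computes_size_eq_monotoneComplexity (n k : ℕ) :
    ∃ G : MonotoneCircuit (PotentialEdge n), G.Computes (cliqueFunction n k) ∧
      G.size = monotoneComplexity (cliqueFunction n k) := by
  obtain ⟨G, hG⟩ := exists_monotoneCircuit_computes_clique n k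
  exact Nat.sInf_mem (s := {s : ℕ | ∃ C : MonotoneCircuit (PotentialEdge n),
    C.Computes (cliqueFunction n k) ∧ C.size = s}) ⟨G.size, G, hG, rfl⟩

theorem rpow_le_monotoneComplexity {n k : ℕ} (hlog : 8640 ≤ Real.log n) {δ : ℝ} (hδ : 0 < δ)
    (hk : 2 ≤ k) (hkδ : (k : ℝ) ≤ (n : ℝ) ^ ((1 : ℝ) / 2 - δ) / (Real.log n) ^ 2) :
    (n : ℝ) ^ (1 / 16 * δ ^ 2 * (k : ℝ)) ≤ monotoneComplexity (cliqueFunction n k) := by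
  obtain ⟨G, hG, hsize⟩ := exists_computes_size_eq_monotoneComplexity n k
  rw [← hsize]
  exact rpow_le_size_of_computes hlog hδ hk hkδ G hG

/-- The choice `δ = log log n / log n`, for which `n ^ δ = log n`, and `k ≈ √n / log³ n`. -/
theorem two_rpow_le_cliqueProblemComplexity {n : ℕ} (hlog : 8640 ≤ Real.log n)
    (hn : (2 * Real.log n ^ 3) ^ 2 ≤ n) :
    (2 : ℝ) ^ (1 / 32 * Real.sqrt n / (Real.log n) ^ 4) ≤ cliqueProblemComplexity n := by
  set L := Real.log n with hL
  have hL0 : 0 < L := by linarith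
  have hn0 : (0 : ℝ) < n := lt_of_lt_of_le (by positivity) hn
  have hlogL : 1 ≤ Real.log L := by
    rw [Real.le_log_iff_exp_le hL0]
    have := Real.exp_one_lt_d9
    linarith
  set δ := Real.log L / L with hδ
  have hδ0 : 0 < δ := by positivity
  have hsqrt : 2 * L ^ 3 ≤ Real.sqrt n := Real.le_sqrt_of_sq_le hn
  set k := ⌊Real.sqrt n / L ^ 3⌋₊ with hk
  have hq2 : 2 ≤ Real.sqrt n / L ^ 3 := by rwa [le_div_iff₀ (by positivity)]
  have hk2 : 2 ≤ k := Nat.le_floor (by exact_mod_cast hq2)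
  have hkle : (k : ℝ) ≤ Real.sqrt n / L ^ 3 := Nat.floor_le (by positivity)
  have hkge : Real.sqrt n / L ^ 3 / 2 ≤ k := by
    have := Nat.lt_floor_add_one (Real.sqrt n / L ^ 3)
    rw [← hk] at this
    linarith
  have hnδ : (n : ℝ) ^ δ = L := by
    rw [Real.rpow_def_of_pos hn0, ← hL, hδ, mul_div_cancel₀ _ hL0.ne', Real.exp_log hL0]
  have hkδ : (k : ℝ) ≤ (n : ℝ) ^ ((1 : ℝ) / 2 - δ) / L ^ 2 := by
    rw [Real.rpow_sub hn0, hnδ, ← Real.sqrt_eq_rpow, div_div, ← pow_succ']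
    exact hkle
  have hkn : k ≤ n := by
    have h1 : Real.sqrt n / L ^ 3 ≤ Real.sqrt n :=
      div_le_self (Real.sqrt_nonneg _) (one_le_pow₀ (by linarith))
    have h2 : Real.sqrt n ≤ n := by
      have h3 : (1 : ℝ) ≤ Real.sqrt n := by linarith
      calc Real.sqrt n ≤ Real.sqrt n * Real.sqrt n := le_mul_of_one_le_left (by positivity) h3
        _ = n := Real.mul_self_sqrt hn0.le
    exact_mod_cast hkle.trans (h1.trans h2)
  have hsup : (monotoneComplexity (cliqueFunction n k) : ℝ) ≤ cliqueProblemComplexity n := by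
    rw [cliqueProblemComplexity]
    exact_mod_cast Finset.le_sup (f := fun k => monotoneComplexity (cliqueFunction n k))
      (Finset.mem_range.2 (Nat.lt_succ_of_le hkn))
  refine le_trans ?_ ((rpow_le_monotoneComplexity hlog hδ0 hk2 hkδ).trans hsup)
  have hexp : 1 / 32 * Real.sqrt n / L ^ 4 ≤ L * (1 / 16 * δ ^ 2 * k) := by
    have h1 : 1 / L ^ 2 ≤ δ ^ 2 := by
      rw [hδ, div_pow]
      gcongr
      exact one_le_pow₀ hlogL
    calc 1 / 32 * Real.sqrt n / L ^ 4 = L * (1 / 16 * (1 / L ^ 2) * (Real.sqrt n / L ^ 3 / 2)) := by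
          field_simp
          norm_num
      _ ≤ _ := by gcongr
  calc (2 : ℝ) ^ (1 / 32 * Real.sqrt n / L ^ 4) ≤
        Real.exp 1 ^ (1 / 32 * Real.sqrt n / L ^ 4) := by
        gcongr
        have := Real.exp_one_gt_d9
        linarith
    _ = Real.exp (1 / 32 * Real.sqrt n / L ^ 4) := by rw [← Real.exp_mul, one_mul]
    _ ≤ Real.exp (L * (1 / 16 * δ ^ 2 * k)) := Real.exp_le_exp.2 hexp
    _ = (n : ℝ) ^ (1 / 16 * δ ^ 2 * (k : ℝ)) := by rw [Real.rpow_def_of_pos hn0]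

end Asymptotics

end CliqueLowerBound

theorem mainTheorem3 :
    (∃ c : ℝ, 0 < c ∧ ∃ N : ℕ, ∀ n : ℕ, N ≤ n → ∀ δ : ℝ, 0 < δ → ∀ k : ℕ, 2 ≤ k →
      (k : ℝ) ≤ (n : ℝ) ^ ((1 : ℝ) / 2 - δ) / (Real.log n) ^ 2 →
      (n : ℝ) ^ (c * δ ^ 2 * (k : ℝ)) ≤ (monotoneComplexity (cliqueFunction n k) : ℝ)) ∧
    (∃ c : ℝ, 0 < c ∧ ∃ a : ℕ, ∃ N : ℕ, ∀ n : ℕ, N ≤ n →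
      (2 : ℝ) ^ (c * Real.sqrt n / (Real.log n) ^ a) ≤ (cliqueProblemComplexity n : ℝ)) := by
  have hlog : ∀ᶠ n : ℕ in Filter.atTop, 8640 ≤ Real.log n :=
    (Real.tendsto_log_atTop.comp tendsto_natCast_atTop_atTop).eventually_ge_atTop 8640
  constructor
  · obtain ⟨N, hN⟩ := Filter.eventually_atTop.1 hlog
    exact ⟨1 / 16, by norm_num, N, fun n hn δ hδ k hk hkδ =>
      CliqueLowerBound.rpow_le_monotoneComplexity (hN n hn) hδ hk hkδ⟩
  · have hpow : ∀ᶠ n : ℕ in Filter.atTop, (2 * Real.log n ^ 3) ^ 2 ≤ n := by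
      have h := (Real.isLittleO_pow_log_id_atTop (n := 6)).bound (by norm_num : (0 : ℝ) < 1 / 4)
      filter_upwards [tendsto_natCast_atTop_atTop.eventually h] with n hn
      simp only [id, Real.norm_eq_abs, Nat.abs_cast] at hn
      have := (le_abs_self _).trans hn
      have h2 : (2 * Real.log n ^ 3) ^ 2 = 4 * Real.log n ^ 6 := by ring
      linarith
    obtain ⟨N, hN⟩ := Filter.eventually_atTop.1 (hlog.and hpow)
    exact ⟨1 / 32, by norm_num, 4, N, fun n hn =>
      CliqueLowerBound.two_rpow_le_cliqueProblemComplexity (hN n hn).1 (hN n hn).2⟩
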